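/- **Setting.** All state, control and output spaces below are Polish spaces with their Borel $\sigma$-algebras; $\mathcal P(\mathbb X)$ is the set of Borel probability measures on $\mathbb X$, and $(\mathbb Y,\mathbf d_{\mathbb Y})$ is a metric space whose topology is Polish. A *general Markov decision process* (gMDP) $\mathbf M=(\mathbb X,\pi,\mathbb T,\mathbb A,h,\mathbb Y)$ consists of a state space $\mathbb X$, an initial law $\pi\in\mathcal P(\mathbb X)$, a control space $\mathbb A$, a Borel stochastic kernel $\mathbb T(\cdot\mid x,u)$ on $\mathbb X$ given $\mathbb X\times\mathbb A$, and a Borel output map $h:\mathbb X\to\mathbb Y$. A *control strategy* $\mathbf C$ for $\mathbf M$ over the horizon $0,\dots,N$ consists of a Polish space $\mathbb X_{\mathbf C}$, a point $x_{\mathbf C0}\in\mathbb X_{\mathbf C}$, and, for $t=0,\dots,N$, universally measurable stochastic kernels $\mathbb T^t_{\mathbf C}(\cdot\mid x_{\mathbf C},x)$ on $\mathbb X_{\mathbf C}$ given $\mathbb X_{\mathbf C}\times\mathbb X$ and universally measurable maps $h^t_{\mathbf C}:\mathbb X_{\mathbf C}\to\mathcal P(\mathbb A)$. The law $\mathbb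 P_{\mathbf C\times\mathbf M}$ on $(\mathbb X\times\mathbb X_{\mathbf C})^{N+1}$ is that of the execution $(x(t),x_{\mathbf C}(t))_{0\le t\le N}$ obtained from $x(0)\sim\pi$, $x_{\mathbf C}(0)=x_{\mathbf C0}$ and, for $0\le t<N$, $x_{\mathbf C}(t+1)\sim\mathbb T^t_{\mathbf C}(\cdot\mid x_{\mathbf C}(t),x(t))$, then $u(t)\sim h^t_{\mathbf C}(x_{\mathbf C}(t+1))$, then $x(t+1)\sim\mathbb T(\cdot\mid x(t),u(t))$. The output trace is $\{y(t)\}_{0:N}$ with $y(t)=h(x(t))$. For a Borel set $\mathcal R\subseteq\mathbb X_1\times\mathbb X_2$, a measure $\mathbb W\in\mathcal P(\mathbb X_1\times\mathbb X_2)$ is a *$\delta$-lifting* of $\mathcal R$ to $(\Delta,\Theta)\in\mathcal P(\mathbb X_1)\times\mathcal P(\mathbb X_2)$ if it has marginals $\Delta$ and $\Theta$ and $\mathbb W(\mathcal R)\ge 1-\delta$; if such a $\mathbb W$ exists we write $\Delta\,\bar{\mathcal R}_\delta\,\Theta$. Let $\mathbf M_i=(\mathbb X_i,\pi_i,\mathbb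 T_i,\mathbb A_i,h_i,\mathbb Y)$, $i=1,2$, be gMDPs with the same output space. We write $\mathbf M_1\preceq^\delta_\varepsilon\mathbf M_2$ if there exist a Borel stochastic kernel $\mathcal U(\cdot\mid u_1,x_1,x_2)$ on $\mathbb A_2$ given $\mathbb A_1\times\mathbb X_1\times\mathbb X_2$, a Borel set $\mathcal R\subseteq\mathbb X_1\times\mathbb X_2$, and a Borel stochastic kernel $\mathbb W(\cdot\mid u_1,x_1,x_2)$ on $\mathbb X_1\times\mathbb X_2$ given $\mathbb A_1\times\mathbb X_1\times\mathbb X_2$, such that 1. $\mathbf d_{\mathbb Y}(h_1(x_1),h_2(x_2))\le\varepsilon$ for all $(x_1,x_2)\in\mathcal R$; 2. for all $(x_1,x_2)\in\mathcal R$ and $u_1\in\mathbb A_1$, $\mathbb W(\cdot\mid u_1,x_1,x_2)$ is a $\delta$-lifting of $\mathcal R$ to the pair $\mathbb T_1(\cdot\mid x_1,u_1)$ and $\int_{\mathbb A_2}\mathbb T_2(\cdot\mid x_2,u_2)\,\mathcal U(du_2\mid u_1,x_1,x_2)$; 3. $\pi_1\,\bar{\mathcal R}_\delta\,\pi_2$.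 For $A\subseteq\mathbb Y^{N+1}$ define $$A_\varepsilon=\{y' \in\mathbb Y^{N+1}\mid \exists\, y\in A:\ \max_{0\le t\le N}\mathbf d_{\mathbb Y}(y'(t),y(t))\le\varepsilon\},\qquad A_{-\varepsilon}=\{y\in\mathbb Y^{N+1}\mid \{y\}_\varepsilon\subseteq A\}.$$ **Theorem.** Let $N\ge 0$, $\varepsilon\in\mathbb R$, $0\le\delta\le1$, and let $\gamma$ be given by $1-\gamma=(1-\delta)^{N+1}$. Suppose $\mathbf M_1\preceq^\delta_\varepsilon\mathbf M_2$. Then for every control strategy $\mathbf C_1$ for $\mathbf M_1$ over $0,\dots,N$ there is a control strategy $\mathbf C_2$ for $\mathbf M_2$ over $0,\dots,N$ such that, for every Borel set $A\subseteq\mathbb Y^{N+1}$, the events $\{y_1\in A_{-\varepsilon}\}$ and $\{y_1\in A_\varepsilon\}$ are measurable for the completion of $\mathbb P_{\mathbf C_1\times\mathbf M_1}$, and $$\mathbb P_{\mathbf C_1\times\mathbf M_1}\big(\{y_1(t)\}_{0:N}\in A_{-\varepsilon}\big)-\gamma\ \le\ \mathbb P_{\mathbf C_2\times\mathbf M_2}\big(\{y_2(t)\}_{0:N}\in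 A\big)\ \le\ \mathbb P_{\mathbf C_1\times\mathbf M_1}\big(\{y_1(t)\}_{0:N}\in A_{\varepsilon}\big)+\gamma .$$ -/

import Mathlib

open MeasureTheory ProbabilityTheory

/-! ### Universal measurability -/

/-- A copy of the type `α`, to be equipped with the σ-algebra of universally measurable sets. -/
structure Universal (α : Type*) where
  /-- the underlying element -/
  val : α

/-- A set is universally measurable if it is measurable for the completion of every Borel
probability measure. -/
instance Universal.instMeasurableSpace (α : Type*) [MeasurableSpace α] :
    MeasurableSpace (Universal α) where
  MeasurableSet' s := ∀ μ : Measure α, IsProbabilityMeasure μ → NullMeasurableSet (mk ⁻¹' s) μ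
  measurableSet_empty := fun _ _ => nullMeasurableSet_empty
  measurableSet_compl := fun _ hs μ hμ => (hs μ hμ).compl
  measurableSet_iUnion := fun f hf μ hμ => by
    rw [Set.preimage_iUnion]
    exact NullMeasurableSet.iUnion fun i => hf i μ hμ

/-- A kernel from `α` to `β` with universally measurable dependence on its argument.  For
probability kernels into a Polish space `β` this is the same as a universally measurable map from
`α` to the space of Borel probability measures on `β`. -/
abbrev UKernel (α β : Type*) [MeasurableSpace α] [MeasurableSpace β] : Type _ :=
  Kernel (Universal α) β

section Universal

variable {α β : Type*} [MeasurableSpace α] [MeasurableSpace β]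

/-- Borel sets are universally measurable. -/
theorem Universal.measurable_val : Measurable (Universal.val : Universal α → α) :=
  fun _ hs _ _ => MeasurableSet.nullMeasurableSet hs

/-- Borel maps are measurable for the universal σ-algebras. -/
theorem Universal.measurable_map {f : α → β} (hf : Measurable f) :
    Measurable (fun a : Universal α => Universal.mk (f a.val)) := fun s hs μ _ => by
  have hp : IsProbabilityMeasure (μ.map f) := Measure.isProbabilityMeasure_map hf.aemeasurable
  have h : NullMeasurableSet (f ⁻¹' (Universal.mk ⁻¹' s)) μ :=
    (hs (μ.map f) hp).preimage ⟨hf, Measure.AbsolutelyContinuous.rfl⟩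
  exact h

/-- Every universally measurable set is Carathéodory measurable for a probability measure. -/
theorem Universal.le_caratheodory (μ : ProbabilityMeasure α) :
    Universal.instMeasurableSpace α ≤
      (OuterMeasure.map Universal.mk (μ : Measure α).toOuterMeasure).caratheodory := by
  intro s hs t
  simp only [OuterMeasure.map_apply, Set.preimage_inter, Set.preimage_sdiff]
  exact (measure_inter_add_sdiff₀ _ (hs μ inferInstance)).symm

/-- The unique extension of a Borel probability measure to the universally measurable sets. -/
noncomputable def extendUniversal (μ : ProbabilityMeasure α) : Measure (Universal α) :=
  (OuterMeasure.map Universal.mk (μ : Measure α).toOuterMeasure).toMeasure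
    (Universal.le_caratheodory μ)

instance extendUniversal.instIsProbabilityMeasure (μ : ProbabilityMeasure α) :
    IsProbabilityMeasure (extendUniversal μ) := by
  constructor
  rw [extendUniversal, toMeasure_apply _ _ MeasurableSet.univ]
  exact measure_univ (μ := (μ : Measure α))

theorem Universal.measurable_val_prod :
    Measurable (fun p : Universal α × β => (p.1.val, p.2)) :=
  (Universal.measurable_val.comp measurable_fst).prodMk measurable_snd

/-- The law `μ(da) κ(db | a)` on `α × β` of a pair obtained by drawing `a` from `μ` and then `b`
from the universally measurable stochastic kernel `κ(· | a)`. -/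
noncomputable def drawNext (μ : ProbabilityMeasure α) (κ : UKernel α β) [IsMarkovKernel κ] :
    ProbabilityMeasure (α × β) :=
  ⟨(extendUniversal μ ⊗ₘ κ).map (fun p : Universal α × β => (p.1.val, p.2)),
    Measure.isProbabilityMeasure_map Universal.measurable_val_prod.aemeasurable⟩

/-- Precomposition of a universally measurable kernel with a Borel map. -/
noncomputable def UKernel.comapBorel {γ : Type*} [MeasurableSpace γ] (κ : UKernel α β)
    (f : γ → α) (hf : Measurable f) : UKernel γ β :=
  Kernel.comap κ (fun c : Universal γ => Universal.mk (f c.val)) (Universal.measurable_map hf)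

instance UKernel.comapBorel.instIsMarkovKernel {γ : Type*} [MeasurableSpace γ] (κ : UKernel α β)
    [IsMarkovKernel κ] (f : γ → α) (hf : Measurable f) : IsMarkovKernel (κ.comapBorel f hf) :=
  inferInstanceAs (IsMarkovKernel (Kernel.comap κ _ (Universal.measurable_map hf)))

/-- A Borel kernel, regarded as a universally measurable kernel. -/
noncomputable def UKernel.ofBorel (κ : Kernel α β) : UKernel α β :=
  Kernel.comap κ Universal.val Universal.measurable_val

instance UKernel.ofBorel.instIsMarkovKernel (κ : Kernel α β) [IsMarkovKernel κ] :
    IsMarkovKernel (UKernel.ofBorel κ) :=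
  inferInstanceAs (IsMarkovKernel (Kernel.comap κ _ Universal.measurable_val))

end Universal

/-! ### General Markov decision processes and control strategies -/

/-- A general Markov decision process with state space `X`, control space `A` and output
space `Y`. -/
structure GMDP (X A Y : Type*) [MeasurableSpace X] [MeasurableSpace A] [MeasurableSpace Y] where
  /-- the initial distribution -/
  init : ProbabilityMeasure X
  /-- the controlled transition kernel `T(· | x, u)` -/
  trans : Kernel (X × A) X
  isMarkovKernel_trans : IsMarkovKernel trans
  /-- the output map -/
  out : X → Y
  measurable_out : Measurable out

attribute [instance] GMDP.isMarkovKernel_trans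

universe u₁ u₂ v₁ v₂ v w

/-- A control strategy over the time horizon `t = 0, …, N` for processes with state space `X` and
control space `A`: an inhomogeneous Markov process, with its own Polish state space, that reads the
state in `X` and outputs a distribution over the controls. -/
structure ControlStrategy (X A : Type*) [MeasurableSpace X] [MeasurableSpace A] (N : ℕ) where
  /-- the internal state space -/
  State : Type w
  [topologicalSpace : TopologicalSpace State]
  [polishSpace : PolishSpace State]
  [measurableSpace : MeasurableSpace State]
  [borelSpace : BorelSpace State]
  /-- the initial internal state -/
  start : State
  /-- the kernels `T_C^t(· | x_C, x)` -/
  trans : Fin (N + 1) → UKernel (State × X) State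
  isMarkovKernel_trans : ∀ t, IsMarkovKernel (trans t)
  /-- the output maps `h_C^t`, from the internal state to the distributions over controls -/
  out : Fin (N + 1) → UKernel State A
  isMarkovKernel_out : ∀ t, IsMarkovKernel (out t)

attribute [instance] ControlStrategy.topologicalSpace ControlStrategy.polishSpace
  ControlStrategy.measurableSpace ControlStrategy.borelSpace
  ControlStrategy.isMarkovKernel_trans ControlStrategy.isMarkovKernel_out

/-! ### Execution of a controlled model -/

section Execution

variable {X A Y : Type*} [MeasurableSpace X] [MeasurableSpace A] [MeasurableSpace Y]

theorem measurable_snoc_const {Z : Type*} [MeasurableSpace Z] (n : ℕ) :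
    Measurable (fun p : (Fin n → Z) × Z => (Fin.snoc p.1 p.2 : Fin (n + 1) → Z)) := by
  refine measurable_pi_lambda _ fun i => ?_
  induction i using Fin.lastCases with
  | last => simpa using measurable_snd
  | cast i => simpa using (by fun_prop : Measurable fun p : (Fin n → Z) × Z => p.1 i)

/-- One round of the execution, at time `t`, on the law `P` of the paths
`(x(s), x_C(s))`, `s = 0, …, t`: draw `x_C(t+1) ∼ T_C^t(· | x_C(t), x(t))`, then the control
`u(t) ∼ h_C^t(x_C(t+1))`, then `x(t+1) ∼ T(· | x(t), u(t))`, and append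
`(x(t+1), x_C(t+1))` to the path. -/
noncomputable def executionStep {N : ℕ} (C : ControlStrategy.{w} X A N) (M : GMDP X A Y)
    (t : ℕ) (ht : t < N + 1) (P : ProbabilityMeasure (Fin (t + 1) → X × C.State)) :
    ProbabilityMeasure (Fin (t + 2) → X × C.State) :=
  let P₁ : ProbabilityMeasure ((Fin (t + 1) → X × C.State) × C.State) :=
    drawNext P ((C.trans ⟨t, ht⟩).comapBorel
      (fun ω => ((ω (Fin.last t)).2, (ω (Fin.last t)).1)) (by fun_prop))
  let P₂ : ProbabilityMeasure (((Fin (t + 1) → X × C.State) × C.State) × A) :=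
    drawNext P₁ ((C.out ⟨t, ht⟩).comapBorel (fun p => p.2) (by fun_prop))
  let P₃ : ProbabilityMeasure ((((Fin (t + 1) → X × C.State) × C.State) × A) × X) :=
    drawNext P₂ ((UKernel.ofBorel M.trans).comapBorel
      (fun p => ((p.1.1 (Fin.last t)).1, p.2)) (by fun_prop))
  P₃.map (f := fun p => (Fin.snoc p.1.1.1 (p.2, p.1.1.2) : Fin (t + 2) → X × C.State))
    ((measurable_snoc_const (Z := X × C.State) (t + 1)).comp
      (f := fun p : ((((Fin (t + 1) → X × C.State) × C.State) × A) × X) =>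
        (p.1.1.1, (p.2, p.1.1.2))) (by fun_prop)).aemeasurable

/-- The law of the path `(x(s), x_C(s))`, `s = 0, …, t`, of the controlled model, for `t ≤ N`. -/
noncomputable def executionUpTo {N : ℕ} (C : ControlStrategy.{w} X A N) (M : GMDP X A Y) :
    (t : ℕ) → t < N + 1 → ProbabilityMeasure (Fin (t + 1) → X × C.State)
  | 0, _ => M.init.map (f := fun x => fun _ => (x, C.start))
      (Measurable.aemeasurable (by fun_prop))
  | t + 1, ht =>
    executionStep C M t (Nat.lt_of_succ_lt ht) (executionUpTo C M t (Nat.lt_of_succ_lt ht))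

/-- The law `P_{C × M}` of the execution `(x(t), x_C(t))`, `t = 0, …, N`, of `M` controlled by
`C`. -/
noncomputable def execution {N : ℕ} (C : ControlStrategy.{w} X A N) (M : GMDP X A Y) :
    Measure (Fin (N + 1) → X × C.State) :=
  (executionUpTo C M N (Nat.lt_succ_self N) : Measure _)

/-- The output trace `y(t) = h(x(t))`, `t = 0, …, N`, of an execution. -/
def outputTrace {N : ℕ} {S : Type*} (M : GMDP X A Y) (ω : Fin (N + 1) → X × S) : Fin (N + 1) → Y :=
  fun t => M.out (ω t).1

end Execution

/-! ### Approximate simulation -/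

/-- `W` is a `δ`-lifting of the relation `R` to the pair `(Δ, Θ)`: a coupling of `Δ` and `Θ` that
gives `R` probability at least `1 - δ`. -/
structure IsDeltaLifting {X₁ X₂ : Type*} [MeasurableSpace X₁] [MeasurableSpace X₂]
    (R : Set (X₁ × X₂)) (δ : ℝ) (Δ : Measure X₁) (Θ : Measure X₂) (W : Measure (X₁ × X₂)) :
    Prop where
  isProbabilityMeasure : IsProbabilityMeasure W
  left_marginal : ∀ B : Set X₁, MeasurableSet B → W (B ×ˢ Set.univ) = Δ B
  right_marginal : ∀ B : Set X₂, MeasurableSet B → W (Set.univ ×ˢ B) = Θ B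
  le_measure : 1 - δ ≤ W.real R

/-- `M₁` is `ε,δ`-stochastically simulated by `M₂`, i.e. `M₁ ⪯_ε^δ M₂`.  Here `U` is the interface
function, `R` the relation and `W` the lifting kernel; the measure `(U (u, x₁, x₂)).bind …` is
`T₂(· | x₂, U(u, x₁, x₂)) = ∫ T₂(· | x₂, u₂) U(du₂ | u, x₁, x₂)`. -/
def ApproxSimulated {X₁ A₁ X₂ A₂ Y : Type*} [MeasurableSpace X₁] [MeasurableSpace A₁]
    [MeasurableSpace X₂] [MeasurableSpace A₂] [MetricSpace Y] [MeasurableSpace Y]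
    (ε δ : ℝ) (M₁ : GMDP X₁ A₁ Y) (M₂ : GMDP X₂ A₂ Y) : Prop :=
  ∃ (U : Kernel (A₁ × X₁ × X₂) A₂) (R : Set (X₁ × X₂)) (W : Kernel (A₁ × X₁ × X₂) (X₁ × X₂)),
    IsMarkovKernel U ∧ IsMarkovKernel W ∧ MeasurableSet R ∧
    (∀ x₁ x₂, (x₁, x₂) ∈ R → dist (M₁.out x₁) (M₂.out x₂) ≤ ε) ∧
    (∀ x₁ x₂, (x₁, x₂) ∈ R → ∀ u : A₁,
      IsDeltaLifting R δ (M₁.trans (x₁, u))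
        ((U (u, x₁, x₂)).bind fun u₂ => M₂.trans (x₂, u₂)) (W (u, x₁, x₂))) ∧
    ∃ Wπ : Measure (X₁ × X₂), IsDeltaLifting R δ (M₁.init : Measure X₁) (M₂.init : Measure X₂) Wπ

/-! ### Expansion and contraction of sets of traces -/

/-- The `ε`-expansion `A_ε`. -/
def epsExpansion {Y : Type*} [MetricSpace Y] {n : ℕ} (ε : ℝ) (A : Set (Fin n → Y)) :
    Set (Fin n → Y) :=
  {y' | ∃ y ∈ A, ∀ t, dist (y' t) (y t) ≤ ε}

/-- The `ε`-contraction `A_{-ε}`. -/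
def epsContraction {Y : Type*} [MetricSpace Y] {n : ℕ} (ε : ℝ) (A : Set (Fin n → Y)) :
    Set (Fin n → Y) :=
  {y | epsExpansion ε {y} ⊆ A}

/-!
Every strategy `C₁` for `M₁` has a refinement `C₂` for `M₂` such that the two executions can be
coupled with `(x₁(t), x₂(t)) ∈ R` for all `t ≤ N`, up to probability `γ`
(`exists_strategy_coupling`).  On that event the two output traces are `ε`-close at all times, so
`y₂ ∈ A` forces `y₁ ∈ A_ε`: this is the upper bound, and the lower bound is the upper bound for the
complement of `A`.

The coupled execution moves the pair of states by the lifting kernel, replaced outside `R` by the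
independent coupling (`exists_coupling_kernel`), so that the marginals are right from every pair of
states.  It stays in `R` with probability at least `1 - δ` in each of the `N + 1` draws, the initial
one included (`pow_le_pathLaw_forall_mem`).  The first model's part of it is a lumped Markov chain,
the execution of `M₁` under `C₁` (`map_pathLaw_of_lumpable`).

A strategy for `M₂` sees `x₂(t)` but not `x₁(t)`.  The refined strategy remembers `x₁(t-1)`,
`x₂(t-1)`, `u₁(t-1)` and the internal state of `C₁`, and draws `x₁(t)` afresh from its conditional
law given these and `x₂(t)`, which is a disintegration of the coupling kernel.  That this reproduces
the second model's part of the coupled execution is an intertwining of Markov chains in the sense of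
Rogers and Pitman (`map_pathLaw_of_intertwining`).

The kernels of `C₁` are universally measurable only, while disintegration of kernels asks for
countably generated σ-algebras.  Since the laws at which the execution evaluates them do not depend
on `C₂`, they may first be replaced by Borel kernels (`exists_isBorelVersion`), and `C₂` is then
Borel.

The set `A_ε` is a projection of a Borel set, hence analytic; its measurability for completed laws
is Lusin's theorem (`MeasureTheory.AnalyticSet.nullMeasurableSet`).
-/

/-! ### Analytic sets are universally measurable -/

section Analytic

open Filter Topology Set

variable {α : Type*} [TopologicalSpace α] [T2Space α] [MeasurableSpace α] [OpensMeasurableSpace α]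

/-- Choquet capacitability of analytic sets, for finite measures: the mass of the continuous image
of the Baire space is approximated from below by that of compact subsets.  The compact set is the
image of a box `{x | ∀ k, x k ≤ l k}`, whose sides are chosen one after the other so that the mass
of the image stays above the level `c`. -/
theorem exists_isCompact_subset_range_le_measure (μ : Measure α) [IsFiniteMeasure μ]
    {f : (ℕ → ℕ) → α} (hf : Continuous f) {c : ENNReal} (hc : c < μ (range f)) :
    ∃ K ⊆ range f, IsCompact K ∧ c ≤ μ K := by
  have step : ∀ (k : ℕ) (T : Set (ℕ → ℕ)), ∃ n, c < μ (f '' T) →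
      c < μ (f '' (T ∩ {x | x k ≤ n})) := by
    intro k T
    by_cases h : c < μ (f '' T)
    · have hU : f '' T = ⋃ n, f '' (T ∩ {x | x k ≤ n}) := by
        rw [← image_iUnion, ← inter_iUnion, iUnion_eq_univ_iff.2 fun x => ⟨x k, by simp⟩, inter_univ]
      have hmono : Monotone fun n => f '' (T ∩ {x | x k ≤ n}) := fun m n hmn =>
        image_mono (inter_subset_inter_right _ fun x (hx : x k ≤ m) => hx.trans hmn)
      rw [hU, hmono.measure_iUnion] at h
      obtain ⟨n, hn⟩ := lt_iSup_iff.1 h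
      exact ⟨n, fun _ => hn⟩
    · exact ⟨0, fun h' => absurd h' h⟩
  choose n hn using step
  let T : ℕ → Set (ℕ → ℕ) := fun k => Nat.rec univ (fun k S => S ∩ {x | x k ≤ n k S}) k
  have hTs : ∀ k, T (k + 1) = T k ∩ {x | x k ≤ n k (T k)} := fun k => rfl
  have hTc : ∀ k, c < μ (f '' T k) := by
    intro k
    induction k with
    | zero => simpa [T] using hc
    | succ k ih => exact hn k _ ih
  have hTanti : Antitone T := antitone_nat_of_succ_le fun k => by rw [hTs]; exact inter_subset_left
  set l : ℕ → ℕ := fun k => n k (T k)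
  have hTl : ∀ k x, x ∈ T k → ∀ i < k, x i ≤ l i := by
    intro k x hx i hi
    have h := hTanti (Nat.succ_le_of_lt hi) hx
    rw [Nat.succ_eq_add_one, hTs] at h
    exact h.2
  set B : Set (ℕ → ℕ) := Set.pi univ fun k => Iic (l k)
  have hB : IsCompact B := isCompact_univ_pi fun k => (finite_Iic (l k)).isCompact
  refine ⟨f '' B, image_subset_range _ _, hB.image hf, ?_⟩
  have hsub : ⋂ k, closure (f '' T k) ⊆ f '' B := by
    intro y hy
    by_contra hyB
    obtain ⟨U, V, hU, hV, hBU, hyV, hUV⟩ :=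
      SeparatedNhds.of_isCompact_isCompact (hB.image hf) isCompact_singleton
        (disjoint_singleton_right.2 hyB)
    have hex : ∃ k, T k ⊆ f ⁻¹' U := by
      by_contra hcon
      choose x hxT hxU using fun k => not_subset.1 (not_exists.1 hcon k)
      -- truncating `x k` at `l` moves it into the box and keeps its first `k` coordinates
      let F : Ultrafilter ℕ := Ultrafilter.of atTop
      have hF : (F : Filter ℕ) ≤ atTop := Ultrafilter.of_le atTop
      have hbox : ∀ k, (fun i => min (x k i) (l i)) ∈ B := fun k i _ =>
        mem_Iic.2 (min_le_right _ _)
      obtain ⟨z, hz, hFz⟩ := isCompact_iff_ultrafilter_le_nhds.1 hB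
        (F.map fun k i => min (x k i) (l i))
        (le_principal_iff.2 (Ultrafilter.mem_map.2 (univ_mem' hbox)))
      have hxz : Tendsto x F (𝓝 z) := by
        rw [tendsto_pi_nhds]
        intro i
        have h1 : Tendsto (fun k => min (x k i) (l i)) F (𝓝 (z i)) :=
          ((continuous_apply i).tendsto z).comp hFz
        refine h1.congr' (hF ?_)
        filter_upwards [eventually_gt_atTop i] with k hk
        exact min_eq_left (hTl k _ (hxT k) i hk)
      have h2 := ((hf.tendsto z).comp hxz).eventually (hU.mem_nhds (hBU ⟨z, hz, rfl⟩))
      obtain ⟨k, hk⟩ := h2.exists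
      exact hxU k hk
    obtain ⟨k, hk⟩ := hex
    obtain ⟨w, hwV, hwT⟩ := mem_closure_iff.1 (mem_iInter.1 hy k) V hV (hyV rfl)
    exact hUV.le_bot ⟨image_subset_iff.2 hk hwT, hwV⟩
  calc c ≤ ⨅ k, μ (closure (f '' T k)) :=
        le_iInf fun k => (hTc k).le.trans (measure_mono subset_closure)
    _ = μ (⋂ k, closure (f '' T k)) := by
        refine (Antitone.measure_iInter (fun i j hij => closure_mono (image_mono (hTanti hij)))
          (fun k => isClosed_closure.measurableSet.nullMeasurableSet)
          ⟨0, measure_ne_top _ _⟩).symm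
    _ ≤ μ (f '' B) := measure_mono hsub

/-- Lusin's theorem: analytic sets are measurable for the completion of every finite Borel
measure. -/
theorem MeasureTheory.AnalyticSet.nullMeasurableSet {s : Set α} (hs : AnalyticSet s)
    (μ : Measure α) [IsFiniteMeasure μ] : NullMeasurableSet s μ := by
  rw [AnalyticSet] at hs
  obtain rfl | ⟨f, hf, rfl⟩ := hs
  · exact nullMeasurableSet_empty
  by_cases h0 : μ (range f) = 0
  · exact NullMeasurableSet.of_null h0
  obtain ⟨u, -, hu, hlim⟩ := exists_seq_strictMono_tendsto' (pos_iff_ne_zero.2 h0)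
  choose K hKs hK hKu using fun n =>
    exists_isCompact_subset_range_le_measure μ hf (hu n).2
  have hm : MeasurableSet (⋃ n, K n) := MeasurableSet.iUnion fun n => (hK n).measurableSet
  have hae : (⋃ n, K n) =ᵐ[μ] range f := by
    refine ae_eq_of_subset_of_measure_ge (iUnion_subset hKs) ?_ hm.nullMeasurableSet
      (measure_ne_top _ _)
    exact le_of_tendsto' hlim fun n => (hKu n).trans (measure_mono (subset_iUnion K n))
  exact hm.nullMeasurableSet.congr hae

end Analytic

/-! ### Expansions and contractions of sets of traces -/

section Expansion

variable {Y : Type*} [MetricSpace Y] {n : ℕ}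

theorem epsContraction_eq_compl_epsExpansion_compl (ε : ℝ) (A : Set (Fin n → Y)) :
    epsContraction ε A = (epsExpansion ε Aᶜ)ᶜ := by
  ext y
  simp only [epsContraction, epsExpansion, Set.mem_ofPred_eq, Set.mem_compl_iff, Set.subset_def,
    Set.mem_singleton_iff, exists_eq_left, not_exists, not_and]
  refine ⟨fun h y' hy' hd => hy' (h y' fun t => ?_), fun h y' hd => ?_⟩
  · rw [dist_comm]; exact hd t
  · by_contra hy'
    exact h y' hy' fun t => by rw [dist_comm]; exact hd t

variable [PolishSpace Y] [MeasurableSpace Y] [BorelSpace Y]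

theorem analyticSet_epsExpansion (ε : ℝ) {A : Set (Fin n → Y)} (hA : MeasurableSet A) :
    AnalyticSet (epsExpansion ε A) := by
  have hm : MeasurableSet {p : (Fin n → Y) × (Fin n → Y) |
      p.2 ∈ A ∧ ∀ t, dist (p.1 t) (p.2 t) ≤ ε} := by
    have h : {p : (Fin n → Y) × (Fin n → Y) | p.2 ∈ A ∧ ∀ t, dist (p.1 t) (p.2 t) ≤ ε} =
        Prod.snd ⁻¹' A ∩ ⋂ t, {p : (Fin n → Y) × (Fin n → Y) | dist (p.1 t) (p.2 t) ≤ ε} := by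
      ext p; simp
    rw [h]
    exact (measurable_snd hA).inter <|
      MeasurableSet.iInter fun t => measurableSet_le (by fun_prop) measurable_const
  have himg : epsExpansion ε A = Prod.fst '' {p : (Fin n → Y) × (Fin n → Y) |
      p.2 ∈ A ∧ ∀ t, dist (p.1 t) (p.2 t) ≤ ε} := by
    ext y
    simp [epsExpansion]
  rw [himg]
  exact hm.analyticSet_image measurable_fst

theorem nullMeasurableSet_epsExpansion (ε : ℝ) {A : Set (Fin n → Y)} (hA : MeasurableSet A)
    {Ω : Type*} [MeasurableSpace Ω] (μ : Measure Ω) [IsFiniteMeasure μ] {g : Ω → Fin n → Y}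
    (hg : Measurable g) : NullMeasurableSet {ω | g ω ∈ epsExpansion ε A} μ :=
  ((analyticSet_epsExpansion ε hA).nullMeasurableSet (μ.map g)).preimage
    (hg.quasiMeasurePreserving μ)

theorem nullMeasurableSet_epsContraction (ε : ℝ) {A : Set (Fin n → Y)} (hA : MeasurableSet A)
    {Ω : Type*} [MeasurableSpace Ω] (μ : Measure Ω) [IsFiniteMeasure μ] {g : Ω → Fin n → Y}
    (hg : Measurable g) : NullMeasurableSet {ω | g ω ∈ epsContraction ε A} μ := by
  rw [epsContraction_eq_compl_epsExpansion_compl]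
  exact (nullMeasurableSet_epsExpansion ε hA.compl μ hg).compl

end Expansion

/-! ### Borel versions of universally measurable kernels -/

section BorelVersion

variable {α β γ : Type*} [MeasurableSpace α] [MeasurableSpace β] [MeasurableSpace γ]

theorem extendUniversal_apply (μ : ProbabilityMeasure α) {s : Set (Universal α)}
    (hs : MeasurableSet s) : extendUniversal μ s = (μ : Measure α) (Universal.mk ⁻¹' s) := by
  rw [extendUniversal, toMeasure_apply _ _ hs]
  rfl

theorem map_val_extendUniversal (μ : ProbabilityMeasure α) :
    (extendUniversal μ).map Universal.val = (μ : Measure α) := by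
  ext s hs
  rw [Measure.map_apply Universal.measurable_val hs,
    extendUniversal_apply μ (Universal.measurable_val hs)]
  rfl

theorem map_extendUniversal (μ : ProbabilityMeasure α) {f : α → γ} (hf : Measurable f) :
    (extendUniversal μ).map (fun a => Universal.mk (f a.val)) =
      extendUniversal (μ.map hf.aemeasurable) := by
  ext s hs
  rw [Measure.map_apply (Universal.measurable_map hf) hs, extendUniversal_apply _ hs,
    extendUniversal_apply _ (Universal.measurable_map hf hs), ProbabilityMeasure.toMeasure_map,
    Measure.map_apply₀ hf.aemeasurable]
  · rfl
  · have h := hs (μ.map hf.aemeasurable : ProbabilityMeasure γ) inferInstance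
    exact h

theorem coe_drawNext (μ : ProbabilityMeasure α) (κ : UKernel α β) [IsMarkovKernel κ] :
    (drawNext μ κ : Measure (α × β)) =
      (extendUniversal μ ⊗ₘ κ).map (fun p : Universal α × β => (p.1.val, p.2)) := rfl

theorem drawNext_ofBorel (μ : ProbabilityMeasure α) (κ : Kernel α β) [IsMarkovKernel κ] :
    (drawNext μ (UKernel.ofBorel κ) : Measure (α × β)) = (μ : Measure α) ⊗ₘ κ := by
  refine Measure.ext_prod fun {s t} hs ht => ?_
  rw [coe_drawNext, Measure.map_apply Universal.measurable_val_prod (hs.prod ht)]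
  change (extendUniversal μ ⊗ₘ UKernel.ofBorel κ) ((Universal.val ⁻¹' s) ×ˢ t) = _
  rw [Measure.compProd_apply_prod (Universal.measurable_val hs) ht,
    Measure.compProd_apply_prod hs ht, ← map_val_extendUniversal μ,
    setLIntegral_map hs (κ.measurable_coe ht) Universal.measurable_val]
  rfl

/-- `κ'` is a Borel version of the universally measurable kernel `κ` with respect to `μ`. -/
def IsBorelVersion (μ : ProbabilityMeasure α) (κ : UKernel α β) (κ' : Kernel α β) : Prop :=
  ∀ᵐ a ∂extendUniversal μ, κ a = κ' a.val

theorem IsBorelVersion.ofBorel (μ : ProbabilityMeasure α) (κ : Kernel α β) :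
    IsBorelVersion μ (UKernel.ofBorel κ) κ :=
  Filter.Eventually.of_forall fun _ => rfl

/-- Every universally measurable stochastic kernel has a Borel version: the regular conditional
distribution of the second component under the joint law `μ(da) κ(db | a)`. -/
theorem exists_isBorelVersion [StandardBorelSpace β] [Nonempty β] (μ : ProbabilityMeasure α)
    (κ : UKernel α β) [IsMarkovKernel κ] :
    ∃ κ' : Kernel α β, IsMarkovKernel κ' ∧ IsBorelVersion μ κ κ' := by
  set ρ : Measure (α × β) := (drawNext μ κ : Measure (α × β)) with hρ
  have hfst : ρ.fst = μ := by
    rw [hρ, coe_drawNext, Measure.fst, Measure.map_map measurable_fst Universal.measurable_val_prod]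
    change (extendUniversal μ ⊗ₘ κ).map (Universal.val ∘ Prod.fst) = _
    rw [← Measure.map_map Universal.measurable_val measurable_fst]
    change (extendUniversal μ ⊗ₘ κ).fst.map _ = _
    rw [Measure.fst_compProd, map_val_extendUniversal]
  have hρ' : (drawNext μ (UKernel.ofBorel ρ.condKernel) : Measure (α × β)) = ρ := by
    rw [drawNext_ofBorel, ← hfst, ρ.disintegrate]
  refine ⟨ρ.condKernel, inferInstance, ?_⟩
  refine Kernel.ae_eq_of_compProd_eq (η := UKernel.ofBorel ρ.condKernel) ?_
  -- a universally measurable set differs from a Borel set by a null set only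
  have key : ∀ (η : UKernel α β) [IsMarkovKernel η] {s : Set (Universal α)} {s' : Set α} {t : Set β},
      MeasurableSet s → MeasurableSet s' → MeasurableSet t →
      s =ᵐ[extendUniversal μ] Universal.val ⁻¹' s' →
      (extendUniversal μ ⊗ₘ η) (s ×ˢ t) = (drawNext μ η : Measure (α × β)) (s' ×ˢ t) := by
    intro η _ s s' t hs hs' ht hss
    rw [Measure.compProd_apply_prod hs ht, setLIntegral_congr hss,
      ← Measure.compProd_apply_prod (Universal.measurable_val hs') ht, coe_drawNext,
      Measure.map_apply Universal.measurable_val_prod (hs'.prod ht)]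
    rfl
  refine Measure.ext_prod fun {s t} hs ht => ?_
  obtain ⟨s', hs', hss⟩ := hs μ inferInstance
  have hss' : s =ᵐ[extendUniversal μ] Universal.val ⁻¹' s' := by
    rw [← measure_symmDiff_eq_zero_iff, extendUniversal_apply μ
      (hs.symmDiff (Universal.measurable_val hs'))]
    exact measure_symmDiff_eq_zero_iff.2 hss
  rw [key κ hs hs' ht hss', key (UKernel.ofBorel ρ.condKernel) hs hs' ht hss', hρ']

/-- In a draw that reads its parameter off `f`, a kernel may be replaced by a Borel version with
respect to the law of `f`. -/
theorem IsBorelVersion.drawNext_comapBorel {P : ProbabilityMeasure γ} {f : γ → α}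
    {hf : Measurable f} {κ : UKernel α β} [IsMarkovKernel κ] {κ' : Kernel α β} [IsMarkovKernel κ']
    (h : IsBorelVersion (P.map hf.aemeasurable) κ κ') :
    (drawNext P (κ.comapBorel f hf) : Measure (γ × β)) = (P : Measure γ) ⊗ₘ κ'.comap f hf := by
  rw [← drawNext_ofBorel, coe_drawNext, coe_drawNext]
  congr 1
  refine Measure.compProd_congr ?_
  rw [IsBorelVersion, ← map_extendUniversal P hf] at h
  exact ae_of_ae_map (Universal.measurable_map hf).aemeasurable h

end BorelVersion

/-! ### Laws of Markov chains -/

section PathLaw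

theorem map_comp_snoc {Z Z' : Type*} {n : ℕ} (p : Z → Z') (ω : Fin n → Z) (z : Z) :
    (fun i => p ((Fin.snoc ω z : Fin (n + 1) → Z) i)) =
      (Fin.snoc (fun i => p (ω i)) (p z) : Fin (n + 1) → Z') := by
  ext i
  induction i using Fin.lastCases <;> simp

open scoped ENNReal

variable {Z Z' : Type*} [MeasurableSpace Z] [MeasurableSpace Z']

/-- The law of the path `(z(0), …, z(t))` of the inhomogeneous Markov chain with initial law `ν`
and transition kernels `Q 0, Q 1, …`. -/
noncomputable def pathLaw (ν : Measure Z) (Q : ℕ → Kernel Z Z) :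
    (t : ℕ) → Measure (Fin (t + 1) → Z)
  | 0 => ν.map fun z _ => z
  | t + 1 => (pathLaw ν Q t ⊗ₘ
      (Q t).comap (fun ω : Fin (t + 1) → Z => ω (Fin.last t)) (by fun_prop)).map
        fun p => (Fin.snoc p.1 p.2 : Fin (t + 2) → Z)

variable {ν : Measure Z} {Q : ℕ → Kernel Z Z} {ν' : Measure Z'} {Q' : ℕ → Kernel Z' Z'}

instance pathLaw.instIsProbabilityMeasure [IsProbabilityMeasure ν] [∀ t, IsMarkovKernel (Q t)]
    (t : ℕ) : IsProbabilityMeasure (pathLaw ν Q t) := by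
  induction t with
  | zero => exact Measure.isProbabilityMeasure_map (Measurable.aemeasurable (by fun_prop))
  | succ t ih => exact Measure.isProbabilityMeasure_map (measurable_snoc_const _).aemeasurable

theorem lintegral_pathLaw_zero {f : (Fin 1 → Z) → ℝ≥0∞} (hf : Measurable f) :
    ∫⁻ ω, f ω ∂pathLaw ν Q 0 = ∫⁻ z, f (fun _ => z) ∂ν := by
  rw [pathLaw, lintegral_map hf (by fun_prop)]

theorem lintegral_pathLaw_succ [IsProbabilityMeasure ν] [∀ t, IsMarkovKernel (Q t)] (t : ℕ)
    {f : (Fin (t + 2) → Z) → ℝ≥0∞} (hf : Measurable f) :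
    ∫⁻ ω, f ω ∂pathLaw ν Q (t + 1) =
      ∫⁻ ω, ∫⁻ z, f (Fin.snoc ω z : Fin (t + 2) → Z) ∂Q t (ω (Fin.last t)) ∂pathLaw ν Q t := by
  have hfs : Measurable fun q : (Fin (t + 1) → Z) × Z =>
    f (Fin.snoc q.1 q.2 : Fin (t + 2) → Z) := hf.comp (measurable_snoc_const _)
  rw [pathLaw, lintegral_map hf (measurable_snoc_const _), Measure.lintegral_compProd hfs]
  rfl

theorem measurable_snoc_right {n : ℕ} (ω : Fin n → Z) :
    Measurable fun z : Z => (Fin.snoc ω z : Fin (n + 1) → Z) :=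
  (measurable_snoc_const n).comp (f := fun z : Z => (ω, z)) (by fun_prop)

/-- Lumping: if the law of `p (z(t+1))` given `z(t)` depends on `p (z(t))` only, then `p (z(t))` is
again a Markov chain. -/
theorem map_pathLaw_of_lumpable [IsProbabilityMeasure ν] [∀ t, IsMarkovKernel (Q t)]
    [IsProbabilityMeasure ν'] [∀ t, IsMarkovKernel (Q' t)] {p : Z → Z'} (hp : Measurable p)
    (hν : ν.map p = ν') (hQ : ∀ t, (Q t).map p = (Q' t).comap p hp) (t : ℕ) :
    (pathLaw ν Q t).map (fun ω i => p (ω i)) = pathLaw ν' Q' t := by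
  have hpm : ∀ n : ℕ, Measurable fun (ω : Fin n → Z) i => p (ω i) := fun n => by fun_prop
  induction t with
  | zero =>
    refine Measure.ext_of_lintegral _ fun f hf => ?_
    have hfp : Measurable fun ω : Fin 1 → Z => f fun i => p (ω i) := hf.comp (hpm _)
    rw [lintegral_map hf (hpm _), lintegral_pathLaw_zero hfp, lintegral_pathLaw_zero hf, ← hν,
      lintegral_map (f := fun z => f fun _ => z) (hf.comp (by fun_prop)) hp]
  | succ t ih =>
    refine Measure.ext_of_lintegral _ fun f hf => ?_
    have hfs : Measurable fun q : (Fin (t + 1) → Z') × Z' =>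
      f (Fin.snoc q.1 q.2 : Fin (t + 2) → Z') := hf.comp (measurable_snoc_const _)
    have hfp : Measurable fun ω : Fin (t + 2) → Z => f fun i => p (ω i) := hf.comp (hpm _)
    rw [lintegral_map hf (hpm _), lintegral_pathLaw_succ t hfp,
      lintegral_pathLaw_succ t hf, ← ih, lintegral_map ?_ (hpm _)]
    · refine lintegral_congr fun ω => ?_
      have h := congrArg (fun κ => κ (ω (Fin.last t))) (hQ t)
      simp only [Kernel.map_apply _ hp, Kernel.comap_apply] at h
      simp only [map_comp_snoc]
      rw [← h]
      exact (lintegral_map (hfs.comp measurable_prodMk_left) hp).symm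
    · exact Measurable.lintegral_kernel_prod_right'
        (κ := (Q' t).comap (fun ω : Fin (t + 1) → Z' => ω (Fin.last t)) (by fun_prop)) hfs

/-- Intertwining (Rogers and Pitman): if `Λ t z'` is carried by the fibre `p z = z'`, and the
kernels `Λ t` intertwine the transitions `Q t` and `Q' t`, then the image under `p` of the chain
with transitions `Q`, started from the law `Λ 0 ∘ ν'`, is the chain with transitions `Q'`.  What
makes the induction work is that `Λ t` is the conditional law of `z(t)` given the path of
`p (z(0)), …, p (z(t))`. -/
theorem map_pathLaw_of_intertwining [IsProbabilityMeasure ν] [∀ t, IsMarkovKernel (Q t)]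
    [IsProbabilityMeasure ν'] [∀ t, IsMarkovKernel (Q' t)] {p : Z → Z'} (hp : Measurable p)
    (Λ : ℕ → Kernel Z' Z) [∀ t, IsMarkovKernel (Λ t)] (hΛ : ∀ t z', ∀ᵐ z ∂Λ t z', p z = z')
    (hν : ν = ν'.bind (Λ 0)) (hQ : ∀ t, Q t ∘ₖ Λ t = Λ (t + 1) ∘ₖ Q' t) (t : ℕ) :
    (pathLaw ν Q t).map (fun ω i => p (ω i)) = pathLaw ν' Q' t := by
  have hpm : ∀ n : ℕ, Measurable fun (ω : Fin n → Z) i => p (ω i) := fun n => by fun_prop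
  have key : ∀ F : (Fin (t + 1) → Z') × Z → ℝ≥0∞, Measurable F →
      ∫⁻ ω, F (fun i => p (ω i), ω (Fin.last t)) ∂pathLaw ν Q t =
        ∫⁻ ω', ∫⁻ z, F (ω', z) ∂Λ t (ω' (Fin.last t)) ∂pathLaw ν' Q' t := by
    induction t with
    | zero =>
      intro F hF
      have h1 : Measurable fun ω : Fin 1 → Z => F (fun i => p (ω i), ω (Fin.last 0)) :=
        hF.comp (by fun_prop)
      have h2 : Measurable fun z : Z => F (fun _ => p z, z) := hF.comp (by fun_prop)
      rw [lintegral_pathLaw_zero h1, lintegral_pathLaw_zero, hν,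
        Measure.lintegral_bind (Λ 0).measurable.aemeasurable h2.aemeasurable]
      · refine lintegral_congr fun z' => lintegral_congr_ae ?_
        filter_upwards [hΛ 0 z'] with z hz
        rw [hz]
      · exact Measurable.lintegral_kernel_prod_right'
          (κ := (Λ 0).comap (fun ω : Fin 1 → Z' => ω (Fin.last 0)) (by fun_prop)) hF
    | succ t ih =>
      intro F hF
      have hm : Measurable fun q : (Fin (t + 2) → Z) => F (fun i => p (q i), q (Fin.last (t + 1))) :=
        hF.comp (by fun_prop)
      have hs : Measurable fun q : ((Fin (t + 1) → Z') × Z) × Z =>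
          F (Fin.snoc q.1.1 (p q.2), q.2) := by
        refine hF.comp (Measurable.prodMk ?_ measurable_snd)
        exact (measurable_snoc_const (t + 1)).comp
          (f := fun q : ((Fin (t + 1) → Z') × Z) × Z => (q.1.1, p q.2)) (by fun_prop)
      have hs' : ∀ ω' : Fin (t + 1) → Z', Measurable fun z =>
          F ((Fin.snoc ω' (p z) : Fin (t + 2) → Z'), z) := fun ω' =>
        hF.comp (((measurable_snoc_right ω').comp hp).prodMk measurable_id)
      rw [lintegral_pathLaw_succ t hm, lintegral_pathLaw_succ t]
      · simp only [map_comp_snoc, Fin.snoc_last]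
        rw [ih (fun q => ∫⁻ z, F (Fin.snoc q.1 (p z), z) ∂Q t q.2)]
        · refine lintegral_congr fun ω' => ?_
          rw [← Kernel.lintegral_comp _ _ _ (hs' ω'), hQ, Kernel.lintegral_comp _ _ _ (hs' ω')]
          refine lintegral_congr fun z' => lintegral_congr_ae ?_
          filter_upwards [hΛ (t + 1) z'] with z hz
          rw [hz]
        · exact Measurable.lintegral_kernel_prod_right'
            (κ := (Q t).comap (fun q : (Fin (t + 1) → Z') × Z => q.2) (by fun_prop)) hs
      · exact Measurable.lintegral_kernel_prod_right'
          (κ := (Λ (t + 1)).comap (fun ω : Fin (t + 2) → Z' => ω (Fin.last (t + 1)))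
            (by fun_prop)) hF
  refine Measure.ext_of_lintegral _ fun f hf => ?_
  rw [lintegral_map hf (hpm _), key (fun q => f q.1) (hf.comp measurable_fst)]
  simp

/-- If each transition from the set `G` stays in `G` with probability at least `c`, then the chain
stays in `G` up to time `t` with probability at least `c ^ (t + 1)`. -/
theorem pow_le_pathLaw_forall_mem [IsProbabilityMeasure ν] [∀ t, IsMarkovKernel (Q t)] {G : Set Z}
    (hG : MeasurableSet G) {c : ℝ≥0∞} (hν : c ≤ ν G) (hQ : ∀ t, ∀ z ∈ G, c ≤ Q t z G) (t : ℕ) :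
    c ^ (t + 1) ≤ pathLaw ν Q t {ω | ∀ s, ω s ∈ G} := by
  have hm : ∀ n : ℕ, MeasurableSet {ω : Fin n → Z | ∀ s, ω s ∈ G} := fun n => by
    rw [Set.ofPred_forall]
    exact MeasurableSet.iInter fun s => measurable_pi_apply s hG
  induction t with
  | zero =>
    rw [pathLaw, Measure.map_apply (by fun_prop) (hm _)]
    simpa using hν
  | succ t ih =>
    rw [← lintegral_indicator_one (hm (t + 2)),
      lintegral_pathLaw_succ t (measurable_one.indicator (hm _))]
    calc c ^ (t + 1 + 1) = c * c ^ (t + 1) := pow_succ' _ _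
      _ ≤ c * pathLaw ν Q t {ω | ∀ s, ω s ∈ G} := by gcongr
      _ = ∫⁻ ω, Set.indicator {ω | ∀ s, ω s ∈ G} (fun _ => c) ω ∂pathLaw ν Q t :=
        (lintegral_indicator_const (hm _) c).symm
      _ ≤ _ := by
        refine lintegral_mono fun ω => ?_
        by_cases hω : ∀ s, ω s ∈ G
        · rw [Set.indicator_of_mem (by exact hω)]
          refine (hQ t _ (hω (Fin.last t))).trans ?_
          rw [← lintegral_indicator_one hG]
          refine lintegral_mono fun z => ?_
          by_cases hz : z ∈ G
          · have : (Fin.snoc ω z : Fin (t + 2) → Z) ∈ {ω : Fin (t + 2) → Z | ∀ s, ω s ∈ G} := by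
              intro s
              induction s using Fin.lastCases with
              | last => simpa using hz
              | cast i => simpa using hω i
            rw [Set.indicator_of_mem hz, Set.indicator_of_mem this]
            simp
          · simp [hz]
        · rw [Set.indicator_of_notMem (by exact hω)]
          exact zero_le

end PathLaw

/-! ### Executions as Markov chains -/

section Execution

open scoped ENNReal

variable {S X A Y : Type*} [MeasurableSpace S] [MeasurableSpace X] [MeasurableSpace A]
  [MeasurableSpace Y]

/-- One round of the execution under a Borel strategy, as a kernel: from the state `x` and the
internal state `s`, draw `s' ∼ T(· | s, x)`, then `u ∼ H(· | s')`, then `x' ∼ M(· | x, u)`, and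
return `(x', s')`. -/
noncomputable def roundKernel (T : Kernel (S × X) S) (H : Kernel S A) (M : Kernel (X × A) X) :
    Kernel (X × S) (X × S) :=
  (((T.comap Prod.swap measurable_swap) ⊗ₖ H.comap (fun p : (X × S) × S => p.2) (by fun_prop)) ⊗ₖ
    M.comap (fun p : (X × S) × (S × A) => (p.1.1, p.2.2)) (by fun_prop)).map
      fun q : (S × A) × X => (q.2, q.1.1)

instance roundKernel.instIsMarkovKernel (T : Kernel (S × X) S) [IsMarkovKernel T] (H : Kernel S A)
    [IsMarkovKernel H] (M : Kernel (X × A) X) [IsMarkovKernel M] :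
    IsMarkovKernel (roundKernel T H M) :=
  Kernel.IsMarkovKernel.map _ (by fun_prop)

theorem lintegral_roundKernel (T : Kernel (S × X) S) [IsMarkovKernel T] (H : Kernel S A)
    [IsMarkovKernel H] (M : Kernel (X × A) X) [IsMarkovKernel M] (z : X × S)
    {f : X × S → ℝ≥0∞} (hf : Measurable f) :
    ∫⁻ z', f z' ∂roundKernel T H M z =
      ∫⁻ s', ∫⁻ u, ∫⁻ x', f (x', s') ∂M (z.1, u) ∂H s' ∂T (z.2, z.1) := by
  have hf' : Measurable fun q : (S × A) × X => f (q.2, q.1.1) := hf.comp (by fun_prop)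
  rw [roundKernel, Kernel.lintegral_map _ (by fun_prop) _ hf, Kernel.lintegral_compProd _ _ _ hf',
    Kernel.lintegral_compProd]
  · rfl
  · exact Measurable.lintegral_kernel_prod_right'
      (κ := (M.comap (fun p : (X × S) × (S × A) => (p.1.1, p.2.2)) (by fun_prop)).comap
        (fun q : S × A => (z, q)) (by fun_prop)) hf'

variable {N : ℕ}

/-- `T` and `H` are Borel versions of the kernels of the strategy at time `t`, with respect to the
laws under which the execution evaluates them when `P` is the law of the path up to time `t`. -/
structure IsBorelVersionAt (C : ControlStrategy.{w} X A N) (t : ℕ) (ht : t < N + 1)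
    (P : ProbabilityMeasure (Fin (t + 1) → X × C.State))
    (T : Kernel (C.State × X) C.State) (H : Kernel C.State A) : Prop where
  trans : IsBorelVersion (P.map (f := fun ω => ((ω (Fin.last t)).2, (ω (Fin.last t)).1))
    (Measurable.aemeasurable (by fun_prop))) (C.trans ⟨t, ht⟩) T
  out : IsBorelVersion ((drawNext P ((C.trans ⟨t, ht⟩).comapBorel
      (fun ω => ((ω (Fin.last t)).2, (ω (Fin.last t)).1)) (by fun_prop))).map
        (f := fun p => p.2) (Measurable.aemeasurable (by fun_prop))) (C.out ⟨t, ht⟩) H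

/-- One round of the execution uses the kernels of the strategy almost everywhere only, so Borel
versions may take their place. -/
theorem executionStep_eq_map_compProd (C : ControlStrategy.{w} X A N) (M : GMDP X A Y)
    (t : ℕ) (ht : t < N + 1) (P : ProbabilityMeasure (Fin (t + 1) → X × C.State))
    {T : Kernel (C.State × X) C.State} [IsMarkovKernel T] {H : Kernel C.State A} [IsMarkovKernel H]
    (h : IsBorelVersionAt C t ht P T H) :
    (executionStep C M t ht P : Measure (Fin (t + 2) → X × C.State)) =
      ((P : Measure _) ⊗ₘ (roundKernel T H M.trans).comap
        (fun ω : Fin (t + 1) → X × C.State => ω (Fin.last t)) (by fun_prop)).map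
          fun p => (Fin.snoc p.1 p.2 : Fin (t + 2) → X × C.State) := by
  have hg : Measurable fun p : ((((Fin (t + 1) → X × C.State) × C.State) × A) × X) =>
      (Fin.snoc p.1.1.1 (p.2, p.1.1.2) : Fin (t + 2) → X × C.State) :=
    (measurable_snoc_const (Z := X × C.State) (t + 1)).comp
      (f := fun p : ((((Fin (t + 1) → X × C.State) × C.State) × A) × X) =>
        (p.1.1.1, (p.2, p.1.1.2))) (by fun_prop)
  refine Measure.ext_of_lintegral _ fun f hf => ?_
  have hfg : Measurable fun p : ((((Fin (t + 1) → X × C.State) × C.State) × A) × X) =>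
      f (Fin.snoc p.1.1.1 (p.2, p.1.1.2) : Fin (t + 2) → X × C.State) := hf.comp hg
  have hfs : Measurable fun q : (Fin (t + 1) → X × C.State) × (X × C.State) =>
    f (Fin.snoc q.1 q.2 : Fin (t + 2) → X × C.State) := hf.comp (measurable_snoc_const _)
  have hM := Measurable.lintegral_kernel_prod_right'
    (κ := M.trans.comap (fun p : ((Fin (t + 1) → X × C.State) × C.State) × A =>
      ((p.1.1 (Fin.last t)).1, p.2)) (by fun_prop)) hfg
  have hH := Measurable.lintegral_kernel_prod_right'
    (κ := H.comap (fun p : (Fin (t + 1) → X × C.State) × C.State => p.2) (by fun_prop)) hM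
  rw [executionStep, ProbabilityMeasure.toMeasure_map, lintegral_map hf hg,
    (IsBorelVersion.ofBorel _ M.trans).drawNext_comapBorel, h.out.drawNext_comapBorel,
    h.trans.drawNext_comapBorel, Measure.lintegral_compProd hfg, Measure.lintegral_compProd hM,
    Measure.lintegral_compProd hH, lintegral_map hf (measurable_snoc_const _),
    Measure.lintegral_compProd hfs]
  refine lintegral_congr fun ω => ?_
  exact (lintegral_roundKernel T H M.trans (ω (Fin.last t))
    (hfs.comp measurable_prodMk_left)).symm

/-- The initial law of `(x(0), x_C(0))`. -/
noncomputable def executionInit (C : ControlStrategy.{w} X A N) (M : GMDP X A Y) :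
    Measure (X × C.State) :=
  (M.init : Measure X).map fun x => (x, C.start)

instance executionInit.instIsProbabilityMeasure (C : ControlStrategy.{w} X A N) (M : GMDP X A Y) :
    IsProbabilityMeasure (executionInit C M) :=
  Measure.isProbabilityMeasure_map (Measurable.aemeasurable (by fun_prop))

theorem executionUpTo_eq_pathLaw (C : ControlStrategy.{w} X A N) (M : GMDP X A Y)
    {T : ℕ → Kernel (C.State × X) C.State} [∀ t, IsMarkovKernel (T t)]
    {H : ℕ → Kernel C.State A} [∀ t, IsMarkovKernel (H t)]
    (h : ∀ t ht, IsBorelVersionAt C t ht (executionUpTo C M t ht) (T t) (H t))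
    (t : ℕ) (ht : t < N + 1) :
    (executionUpTo C M t ht : Measure (Fin (t + 1) → X × C.State)) =
      pathLaw (executionInit C M) (fun t => roundKernel (T t) (H t) M.trans) t := by
  induction t with
  | zero =>
    rw [executionUpTo, pathLaw, executionInit, ProbabilityMeasure.toMeasure_map,
      Measure.map_map (by fun_prop) (by fun_prop)]
    rfl
  | succ t ih =>
    rw [executionUpTo, executionStep_eq_map_compProd C M t _ _ (h t _), pathLaw, ih]

theorem exists_isBorelVersionAt [StandardBorelSpace A] [Nonempty A] (C : ControlStrategy.{w} X A N)
    (t : ℕ) (ht : t < N + 1) (P : ProbabilityMeasure (Fin (t + 1) → X × C.State)) :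
    ∃ (T : Kernel (C.State × X) C.State) (H : Kernel C.State A),
      IsMarkovKernel T ∧ IsMarkovKernel H ∧ IsBorelVersionAt C t ht P T H := by
  have hS : Nonempty C.State := ⟨C.start⟩
  obtain ⟨T, hT, hT'⟩ := exists_isBorelVersion
    (P.map (f := fun ω => ((ω (Fin.last t)).2, (ω (Fin.last t)).1))
      (Measurable.aemeasurable (by fun_prop))) (C.trans ⟨t, ht⟩)
  obtain ⟨H, hH, hH'⟩ := exists_isBorelVersion
    ((drawNext P ((C.trans ⟨t, ht⟩).comapBorel
      (fun ω => ((ω (Fin.last t)).2, (ω (Fin.last t)).1)) (by fun_prop))).map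
        (f := fun p => p.2) (Measurable.aemeasurable (by fun_prop))) (C.out ⟨t, ht⟩)
  exact ⟨T, H, hT, hH, ⟨hT', hH'⟩⟩

/-- Every execution is the law of a Markov chain whose transition kernels are Borel, although those
of the strategy are universally measurable only. -/
theorem exists_borel_executionUpTo_eq_pathLaw [StandardBorelSpace A]
    (C : ControlStrategy.{w} X A N) (M : GMDP X A Y) :
    ∃ (T : ℕ → Kernel (C.State × X) C.State) (H : ℕ → Kernel C.State A)
      (_ : ∀ t, IsMarkovKernel (T t)) (_ : ∀ t, IsMarkovKernel (H t)),
        execution C M =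
          pathLaw (executionInit C M) (fun t => roundKernel (T t) (H t) M.trans) N := by
  have hA : Nonempty A := nonempty_of_isProbabilityMeasure (C.out 0 ⟨C.start⟩)
  have h : ∀ t, ∃ (T : Kernel (C.State × X) C.State) (H : Kernel C.State A),
      IsMarkovKernel T ∧ IsMarkovKernel H ∧
        ∀ ht, IsBorelVersionAt C t ht (executionUpTo C M t ht) T H := by
    intro t
    by_cases ht : t < N + 1
    · obtain ⟨T, H, hT, hH, h⟩ := exists_isBorelVersionAt C t ht (executionUpTo C M t ht)
      exact ⟨T, H, hT, hH, fun _ => h⟩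
    · exact ⟨Kernel.const _ (Measure.dirac C.start),
        Kernel.const _ (Measure.dirac (Classical.arbitrary A)), inferInstance, inferInstance,
        fun ht' => absurd ht' ht⟩
  choose T H hT hH hv using h
  exact ⟨T, H, hT, hH, executionUpTo_eq_pathLaw C M hv N (Nat.lt_succ_self N)⟩

end Execution

/-! ### The coupled execution -/

section Coupling

open scoped ENNReal

/-- The kernel that draws `b ∼ κ(· | a)` and returns `g (a, b)`. -/
noncomputable def drawMap {α β γ : Type*} [MeasurableSpace α] [MeasurableSpace β]
    [MeasurableSpace γ] (κ : Kernel α β) (g : α × β → γ) : Kernel α γ :=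
  (Kernel.id ×ₖ κ).map g

theorem drawMap_apply {α β γ : Type*} [MeasurableSpace α] [MeasurableSpace β] [MeasurableSpace γ]
    (κ : Kernel α β) [IsMarkovKernel κ] {g : α × β → γ} (hg : Measurable g) (a : α) :
    drawMap κ g a = (κ a).map fun b => g (a, b) := by
  rw [drawMap, Kernel.map_apply _ hg, Kernel.prod_apply, Kernel.id_apply, Measure.dirac_prod,
    Measure.map_map hg measurable_prodMk_left]
  rfl

theorem lintegral_drawMap {α β γ : Type*} [MeasurableSpace α] [MeasurableSpace β]
    [MeasurableSpace γ] (κ : Kernel α β) [IsMarkovKernel κ] {g : α × β → γ} (hg : Measurable g)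
    (a : α) {f : γ → ℝ≥0∞} (hf : Measurable f) :
    ∫⁻ c, f c ∂drawMap κ g a = ∫⁻ b, f (g (a, b)) ∂κ a := by
  rw [drawMap_apply κ hg, lintegral_map hf (by fun_prop)]

variable {S X₁ X₂ A₁ A₂ : Type*} [MeasurableSpace S] [MeasurableSpace X₁] [MeasurableSpace X₂]
  [MeasurableSpace A₁] [MeasurableSpace A₂]

/-- The memory of the refined strategy at time `t + 1`: the internal state `x_C(t+1)` of the
original strategy, the states `x₁(t)` and `x₂(t)`, and a code for the control `u₁(t)`.  The control
is coded by a real number, so that the universe of `A₁` does not enter. -/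
abbrev Memory (S X₁ X₂ : Type*) : Type _ := S × X₁ × X₂ × ℝ

/-- The argument `(u₁(t), x₁(t), x₂(t))` of the coupling kernel, read off the memory. -/
def Memory.decode (d : ℝ → A₁) (m : Memory S X₁ X₂) : A₁ × X₁ × X₂ := (d m.2.2.2, m.2.1, m.2.2.1)

theorem Memory.measurable_decode {d : ℝ → A₁} (hd : Measurable d) :
    Measurable (Memory.decode d : Memory S X₁ X₂ → A₁ × X₁ × X₂) := by
  unfold Memory.decode
  fun_prop

/-- The update of the memory in the coupled execution: from `x₁`, `x₂` and a memory with internal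
state `s`, draw `s' ∼ T(· | s, x₁)` and `u₁ ∼ H(· | s')`, and store `(s', x₁, x₂, e u₁)`. -/
noncomputable def memoryKernel (T : Kernel (S × X₁) S) (H : Kernel S A₁) (e : A₁ → ℝ) :
    Kernel (X₁ × X₂ × Memory S X₁ X₂) (Memory S X₁ X₂) :=
  drawMap (T.comap (fun z : X₁ × X₂ × Memory S X₁ X₂ => (z.2.2.1, z.1)) (by fun_prop) ⊗ₖ
      H.comap (fun p : (X₁ × X₂ × Memory S X₁ X₂) × S => p.2) (by fun_prop))
    fun q => (q.2.1, q.1.1, q.1.2.1, e q.2.2)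

/-- The transition of both models in the coupled execution: draw `(x₁', x₂')` from the coupling
kernel `V` at the stored controls and states. -/
noncomputable def coupledDraw (V : Kernel (A₁ × X₁ × X₂) (X₁ × X₂)) {d : ℝ → A₁}
    (hd : Measurable d) : Kernel (Memory S X₁ X₂) (X₁ × X₂ × Memory S X₁ X₂) :=
  drawMap (V.comap (Memory.decode d) (Memory.measurable_decode hd)) fun q => (q.2.1, q.2.2, q.1)

/-- The second model's part of `coupledDraw`. -/
noncomputable def coupledDrawSnd (V : Kernel (A₁ × X₁ × X₂) (X₁ × X₂)) {d : ℝ → A₁}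
    (hd : Measurable d) : Kernel (Memory S X₁ X₂) (X₂ × Memory S X₁ X₂) :=
  drawMap (V.snd.comap (Memory.decode d) (Memory.measurable_decode hd)) fun q => (q.2, q.1)

variable {T : Kernel (S × X₁) S} [IsMarkovKernel T] {H : Kernel S A₁} [IsMarkovKernel H]
  {V : Kernel (A₁ × X₁ × X₂) (X₁ × X₂)} [IsMarkovKernel V] {e : A₁ → ℝ} {d : ℝ → A₁}

theorem isMarkovKernel_memoryKernel (he : Measurable e) :
    IsMarkovKernel (memoryKernel (X₂ := X₂) T H e) :=
  Kernel.IsMarkovKernel.map _ (by fun_prop)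

instance coupledDraw.instIsMarkovKernel (hd : Measurable d) :
    IsMarkovKernel (coupledDraw (S := S) V hd) :=
  Kernel.IsMarkovKernel.map _ (by fun_prop)

instance coupledDrawSnd.instIsMarkovKernel (hd : Measurable d) :
    IsMarkovKernel (coupledDrawSnd (S := S) V hd) :=
  Kernel.IsMarkovKernel.map _ (by fun_prop)

theorem lintegral_memoryKernel (he : Measurable e) (z : X₁ × X₂ × Memory S X₁ X₂)
    {f : Memory S X₁ X₂ → ℝ≥0∞} (hf : Measurable f) :
    ∫⁻ m, f m ∂memoryKernel T H e z =
      ∫⁻ s, ∫⁻ u, f (s, z.1, z.2.1, e u) ∂H s ∂T (z.2.2.1, z.1) := by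
  have hf' : Measurable fun q : S × A₁ => f (q.1, z.1, z.2.1, e q.2) := hf.comp (by fun_prop)
  rw [memoryKernel, lintegral_drawMap _ (by fun_prop) _ hf, Kernel.lintegral_compProd _ _ _ hf']
  rfl

theorem lintegral_coupledDraw (hd : Measurable d) (m : Memory S X₁ X₂)
    {f : X₁ × X₂ × Memory S X₁ X₂ → ℝ≥0∞} (hf : Measurable f) :
    ∫⁻ z, f z ∂coupledDraw V hd m = ∫⁻ v, f (v.1, v.2, m) ∂V (m.decode d) := by
  rw [coupledDraw, lintegral_drawMap _ (by fun_prop) _ hf]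
  rfl

theorem lintegral_coupledDrawSnd (hd : Measurable d) (m : Memory S X₁ X₂)
    {f : X₂ × Memory S X₁ X₂ → ℝ≥0∞} (hf : Measurable f) :
    ∫⁻ z, f z ∂coupledDrawSnd V hd m = ∫⁻ x₂, f (x₂, m) ∂V.snd (m.decode d) := by
  rw [coupledDrawSnd, lintegral_drawMap _ (by fun_prop) _ hf]
  rfl

/-- Forgetting the second model turns one round of the coupled execution into one round of the
execution of the first model. -/
theorem map_coupledDraw_comp_memoryKernel (he : Measurable e) (hd : Measurable d)
    (hde : ∀ u, d (e u) = u) {M₁ : Kernel (X₁ × A₁) X₁} [IsMarkovKernel M₁]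
    (hV : ∀ u x₁ x₂, (V (u, x₁, x₂)).map Prod.fst = M₁ (x₁, u))
    {p : X₁ × X₂ × Memory S X₁ X₂ → X₁ × S} (hp : Measurable p)
    (hpz : ∀ z, p z = (z.1, z.2.2.1)) :
    (coupledDraw V hd ∘ₖ memoryKernel T H e).map p = (roundKernel T H M₁).comap p hp := by
  ext z : 1
  refine Measure.ext_of_lintegral _ fun f hf => ?_
  have hfp : Measurable fun z => f (p z) := hf.comp hp
  rw [Kernel.lintegral_map _ hp _ hf, Kernel.lintegral_comp _ _ _ hfp, Kernel.comap_apply,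
    lintegral_roundKernel _ _ _ _ hf, lintegral_memoryKernel he _ hfp.lintegral_kernel]
  simp only [hpz]
  refine lintegral_congr fun s => lintegral_congr fun u => ?_
  have hfs : Measurable fun x => f (x, s) := hf.comp (by fun_prop)
  rw [lintegral_coupledDraw hd _ (f := fun z => f (z.1, z.2.2.1)) (hf.comp (by fun_prop)),
    ← hV u z.1 z.2.1, lintegral_map hfs measurable_fst]
  simp only [Memory.decode, hde]

/-- The kernel that, given the second model's state and the memory, draws `x₁` from its conditional
law `κ` and returns it together with what was given.  These kernels intertwine the coupled execution
with the execution of the second model. -/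
noncomputable def filterDraw (κ : Kernel (X₂ × Memory S X₁ X₂) X₁) :
    Kernel (X₂ × Memory S X₁ X₂) (X₁ × X₂ × Memory S X₁ X₂) :=
  drawMap κ Prod.swap

instance filterDraw.instIsMarkovKernel (κ : Kernel (X₂ × Memory S X₁ X₂) X₁) [IsMarkovKernel κ] :
    IsMarkovKernel (filterDraw κ) :=
  Kernel.IsMarkovKernel.map _ (by fun_prop)

theorem lintegral_filterDraw (κ : Kernel (X₂ × Memory S X₁ X₂) X₁) [IsMarkovKernel κ]
    (z : X₂ × Memory S X₁ X₂) {f : X₁ × X₂ × Memory S X₁ X₂ → ℝ≥0∞} (hf : Measurable f) :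
    ∫⁻ w, f w ∂filterDraw κ z = ∫⁻ x₁, f (x₁, z) ∂κ z := by
  rw [filterDraw, lintegral_drawMap _ measurable_swap _ hf]
  rfl

theorem ae_filterDraw_snd_eq [MeasurableEq (X₂ × Memory S X₁ X₂)]
    (κ : Kernel (X₂ × Memory S X₁ X₂) X₁) [IsMarkovKernel κ]
    (z : X₂ × Memory S X₁ X₂) : ∀ᵐ w ∂filterDraw κ z, w.2 = z := by
  rw [filterDraw, drawMap_apply κ measurable_swap, ae_map_iff (by fun_prop)]
  · simp
  · exact measurableSet_eq_fun measurable_snd measurable_const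

/-- The transition kernels of the refined strategy: recover a state of the first model from its
conditional law, then update the memory. -/
noncomputable def refinedTrans (κ : Kernel (X₂ × Memory S X₁ X₂) X₁) (T : Kernel (S × X₁) S)
    (H : Kernel S A₁) (e : A₁ → ℝ) : Kernel (Memory S X₁ X₂ × X₂) (Memory S X₁ X₂) :=
  memoryKernel T H e ∘ₖ (filterDraw κ).comap Prod.swap measurable_swap

/-- The output kernel of the refined strategy: the interface function, at the stored controls and
states. -/
noncomputable def refinedOut (U : Kernel (A₁ × X₁ × X₂) A₂) {d : ℝ → A₁} (hd : Measurable d) :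
    Kernel (Memory S X₁ X₂) A₂ :=
  U.comap (Memory.decode d) (Memory.measurable_decode hd)

theorem isMarkovKernel_refinedTrans (κ : Kernel (X₂ × Memory S X₁ X₂) X₁) [IsMarkovKernel κ]
    (he : Measurable e) : IsMarkovKernel (refinedTrans κ T H e) := by
  have := isMarkovKernel_memoryKernel (X₂ := X₂) (T := T) (H := H) he
  unfold refinedTrans
  infer_instance

instance refinedOut.instIsMarkovKernel (U : Kernel (A₁ × X₁ × X₂) A₂) [IsMarkovKernel U]
    (hd : Measurable d) : IsMarkovKernel (refinedOut (S := S) U hd) := by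
  unfold refinedOut
  infer_instance

/-- One round of the second model under the refined strategy is a draw of the first model's state,
a memory update, and the second marginal of the coupled transition.  The averaged control
`∫ M₂(· | x₂, u₂) U(du₂ | u₁, x₁, x₂)` appears because the state `x₂` just stored in the memory is the
one from which the second model moves. -/
theorem roundKernel_refined (κ : Kernel (X₂ × Memory S X₁ X₂) X₁) [IsMarkovKernel κ]
    (he : Measurable e) (hd : Measurable d) {U : Kernel (A₁ × X₁ × X₂) A₂} [IsMarkovKernel U]
    {M₂ : Kernel (X₂ × A₂) X₂} [IsMarkovKernel M₂]
    (hV : ∀ u x₁ x₂, (V (u, x₁, x₂)).map Prod.snd =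
      (U (u, x₁, x₂)).bind fun u₂ => M₂ (x₂, u₂)) :
    roundKernel (refinedTrans κ T H e) (refinedOut U hd) M₂ =
      coupledDrawSnd V hd ∘ₖ (memoryKernel T H e ∘ₖ filterDraw κ) := by
  have := isMarkovKernel_memoryKernel (X₂ := X₂) (T := T) (H := H) he
  have := isMarkovKernel_refinedTrans (T := T) (H := H) κ he
  ext z : 1
  refine Measure.ext_of_lintegral _ fun f hf => ?_
  have hF : Measurable fun m => ∫⁻ u, ∫⁻ x', f (x', m) ∂M₂ (z.1, u) ∂refinedOut U hd m := by
    have h1 : Measurable fun q : (Memory S X₁ X₂ × A₂) × X₂ => f (q.2, q.1.1) :=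
      hf.comp (by fun_prop)
    have h2 := h1.lintegral_kernel_prod_right'
      (κ := M₂.comap (fun q : Memory S X₁ X₂ × A₂ => (z.1, q.2)) (by fun_prop))
    exact h2.lintegral_kernel_prod_right'
  rw [lintegral_roundKernel _ _ _ _ hf, Kernel.lintegral_comp _ _ _ hf, Kernel.lintegral_comp _ _ _
    hf.lintegral_kernel, refinedTrans, Kernel.lintegral_comp _ _ _ hF]
  change ∫⁻ w, _ ∂filterDraw κ z = _
  rw [lintegral_filterDraw _ _ hF.lintegral_kernel,
    lintegral_filterDraw _ _ hf.lintegral_kernel.lintegral_kernel]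
  refine lintegral_congr fun x₁ => ?_
  rw [lintegral_memoryKernel he _ hF,
    lintegral_memoryKernel he _ hf.lintegral_kernel]
  refine lintegral_congr fun s => lintegral_congr fun u => ?_
  have hfm : Measurable fun x₂ => f (x₂, (s, x₁, z.1, e u)) := hf.comp (by fun_prop)
  rw [lintegral_coupledDrawSnd hd _ hf, Kernel.snd_apply]
  simp only [refinedOut, Kernel.comap_apply, Memory.decode]
  rw [hV, Measure.lintegral_bind _ hfm.aemeasurable]
  exact (M₂.measurable.comp measurable_prodMk_left).aemeasurable

/-- Disintegration of the coupling kernel along the second model. -/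
theorem filterDraw_comp_coupledDrawSnd [StandardBorelSpace X₁] [Nonempty X₁]
    [MeasurableSpace.CountableOrCountablyGenerated (A₁ × X₁ × X₂) X₂] (hd : Measurable d)
    {κ : Kernel (X₂ × Memory S X₁ X₂) X₁} [IsMarkovKernel κ]
    (hκ : ∀ x₂ m, κ (x₂, m) = (V.map Prod.swap).condKernel (m.decode d, x₂)) :
    filterDraw κ ∘ₖ coupledDrawSnd V hd = coupledDraw V hd := by
  ext m : 1
  refine Measure.ext_of_lintegral _ fun f hf => ?_
  have hfm : Measurable fun q : X₂ × X₁ => f (q.2, q.1, m) := hf.comp (by fun_prop)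
  rw [Kernel.lintegral_comp _ _ _ hf, lintegral_coupledDrawSnd hd _ hf.lintegral_kernel,
    lintegral_coupledDraw hd _ hf]
  have h : ∫⁻ v, f (v.1, v.2, m) ∂V (m.decode d) =
      ∫⁻ q, f (q.2, q.1, m) ∂(V.map Prod.swap) (m.decode d) :=
    (Kernel.lintegral_map _ measurable_swap _ hfm).symm
  have hfst : (V.map Prod.swap).fst = V.snd := by
    rw [Kernel.fst_eq, Kernel.snd_eq, ← Kernel.map_comp_right _ measurable_swap measurable_fst]
    rfl
  have hV : IsMarkovKernel (V.map Prod.swap) := Kernel.IsMarkovKernel.map _ measurable_swap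
  rw [h, ← (V.map Prod.swap).disintegrate (V.map Prod.swap).condKernel,
    Kernel.lintegral_compProd _ _ _ hfm, hfst]
  refine lintegral_congr fun x₂ => ?_
  rw [lintegral_filterDraw _ _ hf, hκ]

/-- The conditional law of `x₁(t)` given `x₂(t)` and the memory at time `t`: at `t = 0` it comes
from the initial coupling, later from the coupling kernel at the stored controls and states. -/
noncomputable def filterKernel [StandardBorelSpace X₁] [Nonempty X₁]
    [MeasurableSpace.CountableOrCountablyGenerated (A₁ × X₁ × X₂) X₂]
    (Vi : Measure (X₁ × X₂)) [IsProbabilityMeasure Vi] (V : Kernel (A₁ × X₁ × X₂) (X₁ × X₂))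
    [IsMarkovKernel V] {d : ℝ → A₁} (hd : Measurable d) : ℕ → Kernel (X₂ × Memory S X₁ X₂) X₁
  | 0 => (Vi.map Prod.swap).condKernel.comap Prod.fst measurable_fst
  | _ + 1 => (V.map Prod.swap).condKernel.comap (fun z => (z.2.decode d, z.1))
      (((Memory.measurable_decode hd).comp measurable_snd).prodMk measurable_fst)

instance filterKernel.instIsMarkovKernel [StandardBorelSpace X₁] [Nonempty X₁]
    [MeasurableSpace.CountableOrCountablyGenerated (A₁ × X₁ × X₂) X₂]
    (Vi : Measure (X₁ × X₂)) [IsProbabilityMeasure Vi] (hd : Measurable d) (t : ℕ) :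
    IsMarkovKernel (filterKernel (S := S) Vi V hd t) := by
  cases t <;> (unfold filterKernel; infer_instance)

/-- Disintegration of the initial coupling along the second model. -/
theorem bind_filterDraw_zero [StandardBorelSpace X₁] [Nonempty X₁]
    [MeasurableSpace.CountableOrCountablyGenerated (A₁ × X₁ × X₂) X₂]
    (Vi : Measure (X₁ × X₂)) [IsProbabilityMeasure Vi] (hd : Measurable d)
    (m : Memory S X₁ X₂) :
    Vi.map (fun v => (v.1, v.2, m)) =
      ((Vi.map Prod.snd).map fun x₂ => (x₂, m)).bind (filterDraw (filterKernel Vi V hd 0)) := by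
  refine Measure.ext_of_lintegral _ fun f hf => ?_
  have hfm : Measurable fun q : X₂ × X₁ => f (q.2, q.1, m) := hf.comp (by fun_prop)
  have h : ∫⁻ v, f (v.1, v.2, m) ∂Vi = ∫⁻ q, f (q.2, q.1, m) ∂Vi.map Prod.swap :=
    (lintegral_map hfm measurable_swap).symm
  have hfst : (Vi.map Prod.swap).fst = Vi.map Prod.snd := by
    rw [Measure.fst, Measure.map_map measurable_fst measurable_swap]
    rfl
  rw [lintegral_map hf (by fun_prop), h,
    ← (Vi.map Prod.swap).disintegrate (Vi.map Prod.swap).condKernel,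
    Measure.lintegral_compProd hfm, hfst,
    Measure.lintegral_bind (filterDraw _).measurable.aemeasurable hf.aemeasurable,
    lintegral_map hf.lintegral_kernel (by fun_prop)]
  refine lintegral_congr fun x₂ => ?_
  rw [lintegral_filterDraw _ _ hf]
  rfl

/-- From a pair of states in `R`, one round of the coupled execution stays in `R` with the
probability that the coupling kernel gives to `R`. -/
theorem le_coupledDraw_comp_memoryKernel_apply (he : Measurable e) (hd : Measurable d)
    (hde : ∀ u, d (e u) = u) {R : Set (X₁ × X₂)} (hR : MeasurableSet R) {c : ℝ≥0∞}
    {z : X₁ × X₂ × Memory S X₁ X₂} (hc : ∀ u, c ≤ V (u, z.1, z.2.1) R) :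
    c ≤ (coupledDraw V hd ∘ₖ memoryKernel T H e) z {z' | (z'.1, z'.2.1) ∈ R} := by
  have hm : MeasurableSet {z' : X₁ × X₂ × Memory S X₁ X₂ | (z'.1, z'.2.1) ∈ R} :=
    (by fun_prop : Measurable fun z' : X₁ × X₂ × Memory S X₁ X₂ => (z'.1, z'.2.1)) hR
  rw [Kernel.comp_apply' _ _ _ hm, lintegral_memoryKernel he _ (Kernel.measurable_coe _ hm)]
  have h : ∀ (s : S) (u : A₁),
      c ≤ coupledDraw V hd (s, z.1, z.2.1, e u) {z' | (z'.1, z'.2.1) ∈ R} := by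
    intro s u
    rw [coupledDraw, drawMap_apply _ (by fun_prop), Measure.map_apply (by fun_prop) hm]
    have := hc u
    simp only [Kernel.comap_apply, Memory.decode, hde]
    exact this
  calc c = ∫⁻ s, ∫⁻ _u, c ∂H s ∂T (z.2.2.1, z.1) := by simp
    _ ≤ _ := lintegral_mono fun s => lintegral_mono fun u => h s u

end Coupling

/-! ### Liftings as coupling kernels -/

section Lifting

open scoped ENNReal

theorem IsDeltaLifting.map_fst {X₁ X₂ : Type*} [MeasurableSpace X₁] [MeasurableSpace X₂]
    {R : Set (X₁ × X₂)} {δ : ℝ} {Δ : Measure X₁} {Θ : Measure X₂} {W : Measure (X₁ × X₂)}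
    (h : IsDeltaLifting R δ Δ Θ W) : W.map Prod.fst = Δ := by
  ext B hB
  rw [Measure.map_apply measurable_fst hB, ← h.left_marginal B hB, Set.prod_univ]

theorem IsDeltaLifting.map_snd {X₁ X₂ : Type*} [MeasurableSpace X₁] [MeasurableSpace X₂]
    {R : Set (X₁ × X₂)} {δ : ℝ} {Δ : Measure X₁} {Θ : Measure X₂} {W : Measure (X₁ × X₂)}
    (h : IsDeltaLifting R δ Δ Θ W) : W.map Prod.snd = Θ := by
  ext B hB
  rw [Measure.map_apply measurable_snd hB, ← h.right_marginal B hB, Set.univ_prod]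

theorem IsDeltaLifting.ofReal_le_measure {X₁ X₂ : Type*} [MeasurableSpace X₁] [MeasurableSpace X₂]
    {R : Set (X₁ × X₂)} {δ : ℝ} {Δ : Measure X₁} {Θ : Measure X₂} {W : Measure (X₁ × X₂)}
    (h : IsDeltaLifting R δ Δ Θ W) : ENNReal.ofReal (1 - δ) ≤ W R := by
  have := h.isProbabilityMeasure
  exact ENNReal.ofReal_le_of_le_toReal h.le_measure

/-- A lifting kernel couples the transitions of the two models from states in `R` only.  Taking the
independent coupling elsewhere gives a kernel with the right marginals everywhere. -/
theorem exists_coupling_kernel {X₁ X₂ A₁ A₂ : Type*} [MeasurableSpace X₁] [MeasurableSpace X₂]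
    [MeasurableSpace A₁] [MeasurableSpace A₂] {M₁ : Kernel (X₁ × A₁) X₁} [IsMarkovKernel M₁]
    {M₂ : Kernel (X₂ × A₂) X₂} [IsMarkovKernel M₂] {U : Kernel (A₁ × X₁ × X₂) A₂}
    [IsMarkovKernel U] {R : Set (X₁ × X₂)} (hR : MeasurableSet R) {δ : ℝ}
    {W : Kernel (A₁ × X₁ × X₂) (X₁ × X₂)} [IsMarkovKernel W]
    (hW : ∀ x₁ x₂, (x₁, x₂) ∈ R → ∀ u : A₁, IsDeltaLifting R δ (M₁ (x₁, u))
      ((U (u, x₁, x₂)).bind fun u₂ => M₂ (x₂, u₂)) (W (u, x₁, x₂))) :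
    ∃ V : Kernel (A₁ × X₁ × X₂) (X₁ × X₂), IsMarkovKernel V ∧
      (∀ u x₁ x₂, (V (u, x₁, x₂)).map Prod.fst = M₁ (x₁, u)) ∧
      (∀ u x₁ x₂, (V (u, x₁, x₂)).map Prod.snd = (U (u, x₁, x₂)).bind fun u₂ => M₂ (x₂, u₂)) ∧
      ∀ u x₁ x₂, (x₁, x₂) ∈ R → ENNReal.ofReal (1 - δ) ≤ V (u, x₁, x₂) R := by
  classical
  have hRm : MeasurableSet {q : A₁ × X₁ × X₂ | q.2 ∈ R} := measurable_snd hR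
  let K₁ : Kernel (A₁ × X₁ × X₂) X₁ := M₁.comap (fun q => (q.2.1, q.1)) (by fun_prop)
  let L : Kernel (A₁ × X₁ × X₂) (X₂ × A₂) := drawMap U fun q => (q.1.2.2, q.2)
  have hL : IsMarkovKernel L := Kernel.IsMarkovKernel.map _ (by fun_prop)
  let K₂ : Kernel (A₁ × X₁ × X₂) X₂ := M₂ ∘ₖ L
  have hK₂ : ∀ u x₁ x₂, K₂ (u, x₁, x₂) = (U (u, x₁, x₂)).bind fun u₂ => M₂ (x₂, u₂) := by
    intro u x₁ x₂
    have hM : Measurable fun u₂ => M₂ (x₂, u₂) := M₂.measurable.comp measurable_prodMk_left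
    refine Measure.ext_of_lintegral _ fun f hf => ?_
    rw [Kernel.lintegral_comp _ _ _ hf, lintegral_drawMap _ (by fun_prop) _ hf.lintegral_kernel,
      Measure.lintegral_bind hM.aemeasurable hf.aemeasurable]
  refine ⟨Kernel.piecewise hRm W (K₁ ×ₖ K₂), inferInstance, fun u x₁ x₂ => ?_, fun u x₁ x₂ => ?_,
    fun u x₁ x₂ hx => ?_⟩
  · rw [Kernel.piecewise_apply]
    split_ifs with hx
    · exact (hW x₁ x₂ hx u).map_fst
    · rw [Kernel.prod_apply]
      exact Measure.fst_prod
  · rw [Kernel.piecewise_apply]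
    split_ifs with hx
    · exact (hW x₁ x₂ hx u).map_snd
    · rw [Kernel.prod_apply, ← hK₂]
      exact Measure.snd_prod
  · rw [Kernel.piecewise_apply, if_pos (by exact hx)]
    exact (hW x₁ x₂ hx u).ofReal_le_measure

end Lifting

/-! ### The refined strategy and the comparison of probabilities -/

section Refinement

open scoped ENNReal

/-- Under approximate simulation each strategy for the first model has a strategy for the second
such that the two executions can be coupled with all pairs of states in `R`, up to probability
`1 - (1 - δ) ^ (N + 1)`. -/
theorem exists_strategy_coupling
    {X₁ : Type u₁} {X₂ : Type u₂} {A₁ : Type v₁} {A₂ : Type v₂} {Y : Type v}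
    [TopologicalSpace X₁] [PolishSpace X₁] [MeasurableSpace X₁] [BorelSpace X₁]
    [TopologicalSpace X₂] [PolishSpace X₂] [MeasurableSpace X₂] [BorelSpace X₂]
    [TopologicalSpace A₁] [PolishSpace A₁] [MeasurableSpace A₁] [BorelSpace A₁]
    [MeasurableSpace A₂] [MeasurableSpace Y] (M₁ : GMDP X₁ A₁ Y) (M₂ : GMDP X₂ A₂ Y)
    {N : ℕ} {δ : ℝ} {U : Kernel (A₁ × X₁ × X₂) A₂} [IsMarkovKernel U] {R : Set (X₁ × X₂)}
    (hR : MeasurableSet R) {W : Kernel (A₁ × X₁ × X₂) (X₁ × X₂)} [IsMarkovKernel W]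
    (hW : ∀ x₁ x₂, (x₁, x₂) ∈ R → ∀ u : A₁, IsDeltaLifting R δ (M₁.trans (x₁, u))
      ((U (u, x₁, x₂)).bind fun u₂ => M₂.trans (x₂, u₂)) (W (u, x₁, x₂)))
    {Vi : Measure (X₁ × X₂)}
    (hVi : IsDeltaLifting R δ (M₁.init : Measure X₁) (M₂.init : Measure X₂) Vi)
    (C₁ : ControlStrategy.{w} X₁ A₁ N) :
    ∃ (C₂ : ControlStrategy.{max u₁ u₂ w} X₂ A₂ N)
      (J : Measure (Fin (N + 1) → X₁ × X₂ × C₂.State))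
      (p : X₁ × X₂ × C₂.State → X₁ × C₁.State),
      IsProbabilityMeasure J ∧ Measurable p ∧ (∀ z, (p z).1 = z.1) ∧
      J.map (fun ω i => p (ω i)) = execution C₁ M₁ ∧
      J.map (fun ω i => (ω i).2) = execution C₂ M₂ ∧
      ENNReal.ofReal (1 - δ) ^ (N + 1) ≤ J {ω | ∀ s, ((ω s).1, (ω s).2.1) ∈ R} := by
  obtain ⟨V, hV, hV₁, hV₂, hVR⟩ := exists_coupling_kernel hR hW
  have := hVi.isProbabilityMeasure
  have hX : Nonempty (X₁ × X₂) := nonempty_of_isProbabilityMeasure Vi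
  have hX₁ : Nonempty X₁ := hX.map Prod.fst
  have hA : Nonempty A₁ := nonempty_of_isProbabilityMeasure (C₁.out 0 ⟨C₁.start⟩)
  have he : MeasurableEmbedding (embeddingReal A₁) := measurableEmbedding_embeddingReal A₁
  set e : A₁ → ℝ := embeddingReal A₁
  obtain ⟨d, hd, hde'⟩ := he.exists_measurable_extend measurable_id fun _ => hA
  have hde : ∀ u, d (e u) = u := congrFun hde'
  obtain ⟨T, H, hT, hH, hC₁⟩ := exists_borel_executionUpTo_eq_pathLaw C₁ M₁
  have hmem : ∀ t, IsMarkovKernel (memoryKernel (X₂ := X₂) (T t) (H t) e) := fun t =>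
    isMarkovKernel_memoryKernel he.measurable
  let κ : ℕ → Kernel (X₂ × Memory C₁.State X₁ X₂) X₁ := filterKernel Vi V hd
  have hκ : ∀ t, IsMarkovKernel (κ t) := fun t => filterKernel.instIsMarkovKernel Vi hd t
  have hT₂ : ∀ t, IsMarkovKernel (refinedTrans (κ t) (T t) (H t) e) := fun t =>
    isMarkovKernel_refinedTrans _ he.measurable
  -- the first step reads only the component `C₁.start` of the initial memory
  let m₀ : Memory C₁.State X₁ X₂ :=
    (C₁.start, (Classical.arbitrary (X₁ × X₂)).1, (Classical.arbitrary (X₁ × X₂)).2, 0)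
  let C₂ : ControlStrategy.{max u₁ u₂ w} X₂ A₂ N :=
    { State := Memory C₁.State X₁ X₂
      start := m₀
      trans := fun t => UKernel.ofBorel (refinedTrans (κ t) (T t) (H t) e)
      isMarkovKernel_trans := fun t => inferInstance
      out := fun _ => UKernel.ofBorel (refinedOut U hd)
      isMarkovKernel_out := fun t => inferInstance }
  let ν₂ : Measure (X₂ × Memory C₁.State X₁ X₂) := (M₂.init : Measure X₂).map fun x => (x, m₀)
  have hν₂ : IsProbabilityMeasure ν₂ :=
    Measure.isProbabilityMeasure_map (Measurable.aemeasurable (by fun_prop))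
  have hC₂ : execution C₂ M₂ = pathLaw ν₂
      (fun t => roundKernel (refinedTrans (κ t) (T t) (H t) e) (refinedOut U hd) M₂.trans) N :=
    executionUpTo_eq_pathLaw C₂ M₂ (T := fun t => refinedTrans (κ t) (T t) (H t) e)
      (H := fun _ => refinedOut U hd)
      (fun t ht => ⟨IsBorelVersion.ofBorel _ _, IsBorelVersion.ofBorel _ _⟩) N _
  let ν : Measure (X₁ × X₂ × Memory C₁.State X₁ X₂) := Vi.map fun v => (v.1, v.2, m₀)
  have hν : IsProbabilityMeasure ν :=
    Measure.isProbabilityMeasure_map (Measurable.aemeasurable (by fun_prop))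
  let Q : ℕ → Kernel (X₁ × X₂ × Memory C₁.State X₁ X₂) (X₁ × X₂ × Memory C₁.State X₁ X₂) :=
    fun t => coupledDraw V hd ∘ₖ memoryKernel (T t) (H t) e
  have hQ : ∀ t, IsMarkovKernel (Q t) := fun t => inferInstance
  let p : X₁ × X₂ × Memory C₁.State X₁ X₂ → X₁ × C₁.State := fun z => (z.1, z.2.2.1)
  have hp : Measurable p := by fun_prop
  refine ⟨C₂, pathLaw ν Q N, p, inferInstance, hp, fun _ => rfl, ?_, ?_, ?_⟩
  · rw [hC₁]
    refine map_pathLaw_of_lumpable hp ?_ (fun t =>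
      map_coupledDraw_comp_memoryKernel he.measurable hd hde hV₁ hp fun _ => rfl) N
    rw [executionInit, ← hVi.map_fst, Measure.map_map hp (by fun_prop),
      Measure.map_map (by fun_prop) measurable_fst]
    rfl
  · rw [hC₂]
    refine map_pathLaw_of_intertwining measurable_snd (fun t => filterDraw (κ t))
      (fun t z => ae_filterDraw_snd_eq _ z) ?_ (fun t => ?_) N
    · change _ = Measure.bind (Measure.map _ _) _
      rw [← hVi.map_snd]
      exact bind_filterDraw_zero Vi hd m₀
    · rw [roundKernel_refined (κ t) he.measurable hd hV₂, ← Kernel.comp_assoc,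
        filterDraw_comp_coupledDrawSnd hd fun _ _ => rfl, Kernel.comp_assoc]
  · have hG : MeasurableSet {z : X₁ × X₂ × Memory C₁.State X₁ X₂ | (z.1, z.2.1) ∈ R} :=
      (by fun_prop : Measurable fun z : X₁ × X₂ × Memory C₁.State X₁ X₂ => (z.1, z.2.1)) hR
    refine pow_le_pathLaw_forall_mem hG ?_ (fun t z hz => ?_) N
    · rw [Measure.map_apply (by fun_prop) hG]
      exact hVi.ofReal_le_measure
    · exact le_coupledDraw_comp_memoryKernel_apply he.measurable hd hde hR fun u => hVR u _ _ hz

theorem measurable_outputTrace {X A Y S : Type*} [MeasurableSpace X] [MeasurableSpace A]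
    [MeasurableSpace Y] [MeasurableSpace S] (M : GMDP X A Y) (N : ℕ) :
    Measurable fun ω : Fin (N + 1) → X × S => outputTrace M ω := by
  have := M.measurable_out
  unfold outputTrace
  fun_prop

end Refinement

theorem mainTheorem1
    {X₁ : Type u₁} {X₂ : Type u₂} {A₁ : Type v₁} {A₂ : Type v₂} {Y : Type v}
    [TopologicalSpace X₁] [PolishSpace X₁] [MeasurableSpace X₁] [BorelSpace X₁]
    [TopologicalSpace X₂] [PolishSpace X₂] [MeasurableSpace X₂] [BorelSpace X₂]
    [TopologicalSpace A₁] [PolishSpace A₁] [MeasurableSpace A₁] [BorelSpace A₁]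
    [TopologicalSpace A₂] [PolishSpace A₂] [MeasurableSpace A₂] [BorelSpace A₂]
    [MetricSpace Y] [PolishSpace Y] [MeasurableSpace Y] [BorelSpace Y]
    (M₁ : GMDP X₁ A₁ Y) (M₂ : GMDP X₂ A₂ Y) (N : ℕ)
    (ε δ γ : ℝ) (hδ₀ : 0 ≤ δ) (hδ₁ : δ ≤ 1) (hγ : 1 - γ = (1 - δ) ^ (N + 1))
    (hsim : ApproxSimulated ε δ M₁ M₂) :
    ∀ C₁ : ControlStrategy.{w} X₁ A₁ N,
      ∃ C₂ : ControlStrategy.{max u₁ u₂ w} X₂ A₂ N,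
        ∀ A : Set (Fin (N + 1) → Y), MeasurableSet A →
          -- the two modified events are measurable for the completed law
          NullMeasurableSet {ω | outputTrace M₁ ω ∈ epsContraction ε A} (execution C₁ M₁) ∧
          NullMeasurableSet {ω | outputTrace M₁ ω ∈ epsExpansion ε A} (execution C₁ M₁) ∧
          (execution C₁ M₁).real {ω | outputTrace M₁ ω ∈ epsContraction ε A} - γ
            ≤ (execution C₂ M₂).real {ω | outputTrace M₂ ω ∈ A} ∧
          (execution C₂ M₂).real {ω | outputTrace M₂ ω ∈ A}
            ≤ (execution C₁ M₁).real {ω | outputTrace M₁ ω ∈ epsExpansion ε A} + γ := by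
  intro C₁
  obtain ⟨U, R, W, hU, hWk, hR, hdist, hW, Vi, hVi⟩ := hsim
  obtain ⟨C₂, J, p, hJ, hp, hp1, hJ₁, hJ₂, hJR⟩ :=
    exists_strategy_coupling M₁ M₂ hR hW hVi C₁
  refine ⟨C₂, ?_⟩
  have hP₁ : IsProbabilityMeasure (execution C₁ M₁) := by unfold execution; infer_instance
  have hP₂ : IsProbabilityMeasure (execution C₂ M₂) := by unfold execution; infer_instance
  have hcon : ∀ {A : Set (Fin (N + 1) → Y)}, MeasurableSet A →
      NullMeasurableSet {ω | outputTrace M₁ ω ∈ epsContraction ε A} (execution C₁ M₁) :=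
    fun hA => nullMeasurableSet_epsContraction ε hA _ (measurable_outputTrace M₁ N)
  have hexp : ∀ {A : Set (Fin (N + 1) → Y)}, MeasurableSet A →
      NullMeasurableSet {ω | outputTrace M₁ ω ∈ epsExpansion ε A} (execution C₁ M₁) :=
    fun hA => nullMeasurableSet_epsExpansion ε hA _ (measurable_outputTrace M₁ N)
  -- `γ` bounds the probability that the coupled states leave `R` at some time
  have hbad : J.real {ω | ∀ s, ((ω s).1, (ω s).2.1) ∈ R}ᶜ ≤ γ := by
    have hm : MeasurableSet
        {ω : Fin (N + 1) → X₁ × X₂ × C₂.State | ∀ s, ((ω s).1, (ω s).2.1) ∈ R} := by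
      rw [Set.ofPred_forall]
      exact MeasurableSet.iInter fun s => (by fun_prop : Measurable
        fun ω : Fin (N + 1) → X₁ × X₂ × C₂.State => ((ω s).1, (ω s).2.1)) hR
    have h : (1 - δ) ^ (N + 1) ≤ J.real {ω | ∀ s, ((ω s).1, (ω s).2.1) ∈ R} := by
      have h' := ENNReal.toReal_mono (measure_ne_top _ _) hJR
      rwa [ENNReal.toReal_pow, ENNReal.toReal_ofReal (by linarith)] at h'
    rw [probReal_compl_eq_one_sub hm]
    linarith
  have hout : ∀ {A : Set (Fin (N + 1) → Y)}, MeasurableSet A →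
      MeasurableSet {ω : Fin (N + 1) → X₂ × C₂.State | outputTrace M₂ ω ∈ A} :=
    fun hA => measurable_outputTrace M₂ N hA
  have upper : ∀ {A : Set (Fin (N + 1) → Y)}, MeasurableSet A →
      (execution C₂ M₂).real {ω | outputTrace M₂ ω ∈ A} ≤
        (execution C₁ M₁).real {ω | outputTrace M₁ ω ∈ epsExpansion ε A} + γ := by
    intro A hA
    have h₁ := hexp hA
    rw [← hJ₁] at h₁ ⊢
    rw [← hJ₂, map_measureReal_apply (by fun_prop) (hout hA),
      measureReal_def (J.map _), Measure.map_apply₀ (Measurable.aemeasurable (by fun_prop)) h₁,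
      ← measureReal_def]
    refine (measureReal_mono ?_).trans ((measureReal_union_le _ _).trans
      (add_le_add_right hbad _))
    intro ω hω
    by_cases hωR : ∀ s, ((ω s).1, (ω s).2.1) ∈ R
    · refine Or.inl ⟨_, hω, fun t => ?_⟩
      simp only [outputTrace, hp1]
      exact hdist _ _ (hωR t)
    · exact Or.inr hωR
  refine fun A hA => ⟨hcon hA, hexp hA, ?_, upper hA⟩
  -- the lower bound for `A` is the upper bound for its complement
  have h := upper hA.compl
  have h₂ : {ω | outputTrace M₂ ω ∈ Aᶜ} = {ω : Fin (N + 1) → X₂ × C₂.State |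
      outputTrace M₂ ω ∈ A}ᶜ := rfl
  have h₁ : {ω | outputTrace M₁ ω ∈ epsExpansion ε Aᶜ} = {ω : Fin (N + 1) → X₁ × C₁.State |
      outputTrace M₁ ω ∈ epsContraction ε A}ᶜ := by
    rw [epsContraction_eq_compl_epsExpansion_compl]
    ext ω
    simp
  rw [h₂, h₁, probReal_compl_eq_one_sub (hout hA),
    probReal_compl_eq_one_sub₀ (hcon hA)] at h
  linarith
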